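/- Setting. The language $\mathcal L_0$ of intuitionistic analysis has number variables $x,y,\dots$, choice sequence variables $\alpha,\beta,\dots$ (for functions $\mathbb N\to\mathbb N$), names for all primitive recursive functions, terms $\alpha(t)$, equality of numbers, and quantifiers of both sorts. All theories are based on two-sorted intuitionistic predicate logic with equality of numbers. Finite sequences are coded by numbers; $x\star y$ is the code of the concatenation and $\bar\beta(x)$ the code of $\langle\beta(0),\dots,\beta(x-1)\rangle$. Write $\alpha\in K_0$ for $\forall x\forall y(\alpha(x)\ne0\to\alpha(x\star y)=\alpha(x))\wedge\forall\beta\exists x\,\alpha(\bar\beta(x))\ne0$, and $y=\gamma(\alpha)$ for $\exists z\,(y+1=\gamma(\bar\alpha(z)))$; $\gamma|\alpha=\beta$ means $\forall x\exists z\,(\beta(x)+1=\gamma(\langle x\rangle\star\bar\alpha(z)))$. $\mathsf{FIM}_0$ has as axioms: those of Heyting arithmetic, with induction for all formulas, $x=y\to\alpha(x)=\alpha(y)$, and the defining equations of all primitive recursive functions; the scheme $\exists\alpha\forall x\,(\alpha(x)=t(x))$ for all terms $t(x)$ in which $\alpha$ is not free; and the continuity scheme BC-N: $\forall\alpha\exists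 x A(\alpha,x)\to\exists\gamma\in K_0\,\forall\alpha A(\alpha,\gamma(\alpha))$. $\mathsf{FIM}$ (Kleene and Vesley) is $\mathsf{FIM}_0$ together with countable choice $\forall x\exists\alpha A(x,\alpha)\to\exists\beta\forall x A(x,\lambda y.\beta(\mathrm{pair}(x,y)))$, bar induction for decidable bars, and continuity for functions $\forall\alpha\exists\beta A(\alpha,\beta)\to\exists\gamma\in K_0\,\forall\alpha A(\alpha,\gamma|\alpha)$. Extend the formulas of $\mathcal L_0$ by a formation rule $A\mapsto\Box_tA$ for number terms $t$. The extended $\Delta^0_0$ formulas are built by propositional connectives and bounded number quantifiers from equations and formulas $\Box_nB$, where $n$ is a number variable and $B$ has no free number variables (choice sequence parameters are allowed). The language $\mathcal L_K$ further has a function symbol $\chi_A$ for each extended $\Delta^0_0$ formula $A$, whose arguments are the free number and choice sequence variables of $A$. $\mathsf{FIM}_0^+$ is the theory in $\mathcal L_K$ whose axioms are the arithmetical axioms of $\mathsf{FIM}_0$ with induction for all formulas of $\mathcal L_K$, the axioms $(\chi_A=1\leftrightarrow A)\wedge(\chi_A=0\leftrightarrow\neg A)$, the scheme $\exists\alpha\forall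 x\,(\alpha(x)=t(x))$ for all terms of $\mathcal L_K$, and BC-N for formulas of $\mathcal L_0$. $\mathsf{CS}$ consists of the axioms, for all formulas $A$ of $\mathcal L_K$: (CS1) $\Box_nA\vee\neg\Box_nA$; (CS2) $A\to\neg\neg\exists n\,\Box_nA$; (CS3) $\exists n\,\Box_nA\to A$ ($n$ not free in $A$). Let GMP be the sentence $\forall\alpha(\neg\neg\exists x\,\alpha(x)=0\to\exists x\,\alpha(x)=0)$. Proposition. $\mathsf{FIM}_0^++\mathsf{CS}$ is a non-conservative extension of $\mathsf{FIM}_0$: it proves every theorem of $\mathsf{FIM}_0$, but some sentence of $\mathcal L_0$ is provable in $\mathsf{FIM}_0^++\mathsf{CS}$ and not in $\mathsf{FIM}_0$. It is not conservative over $\mathsf{FIM}$ either: some sentence of $\mathcal L_0$ is provable in $\mathsf{FIM}_0^++\mathsf{CS}$ and not in $\mathsf{FIM}$. In fact $\mathsf{FIM}_0^++\mathsf{CS}\vdash\neg\mathrm{GMP}$, while $\mathsf{FIM}+\mathrm{GMP}$ is consistent. -/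

import Mathlib

namespace CreatingSubject

/-! ### Names for primitive recursive functions -/

/-- Names (definitions) of primitive recursive functions, by arity. The recursion
`prec f g` is on the first argument:
`h(0, x) = f(x)`, `h(y + 1, x) = g(y, h(y, x), x)`. -/
inductive PR : ℕ → Type
  | zero : PR 0
  | succ : PR 1
  | proj {n : ℕ} (i : Fin n) : PR n
  | comp {k n : ℕ} (f : PR k) (g : Fin k → PR n) : PR n
  | prec {n : ℕ} (f : PR n) (g : PR (n + 2)) : PR (n + 1)

namespace PR

/-- The constant `0` with `n` dummy arguments. -/
def null {n : ℕ} : PR n := comp zero ![]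

/-- The constant `1` with `n` dummy arguments. -/
def one {n : ℕ} : PR n := comp succ ![null]

/-- `y + x`, with `0 + x = x` and `(y + 1) + x = (y + x) + 1`. -/
def add : PR 2 := prec (proj 0) (comp succ ![proj 1])

/-- The predecessor. -/
def pred : PR 1 := prec zero (proj 0)

/-- Truncated subtraction `x ∸ y`. -/
def sub : PR 2 := comp (prec (proj 0) (comp pred ![proj 1])) ![proj 1, proj 0]

/-- Triangular numbers: `T 0 = 0`, `T (y + 1) = (y + T y) + 1`. -/
def tri : PR 1 := prec zero (comp succ ![comp add ![proj 0, proj 1]])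

/-- The largest `r` with `T r ≤ n`. -/
def root : PR 1 :=
  prec zero (comp add ![proj 1,
    comp sub ![one, comp sub ![comp tri ![comp succ ![proj 1]], comp succ ![proj 0]]]])

/-- The pairing bijection `(x, y) ↦ T (x + y) + y`. -/
def pair : PR 2 := comp add ![comp tri ![comp add ![proj 0, proj 1]], proj 1]

/-- Second projection of the pairing. -/
def snd : PR 1 := comp sub ![proj 0, comp tri ![root]]

/-- First projection of the pairing. -/
def fst : PR 1 := comp sub ![root, snd]

/-- Finite sequences are coded bijectively by numbers: `0` is the empty sequence, and
`cons a x = 1 + pair a x` is the sequence `a` followed by the sequence coded by `x`. -/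
def cons : PR 2 := comp succ ![pair]

/-- First entry (`0` for the empty sequence). -/
def head : PR 1 := comp fst ![pred]

/-- The sequence without its first entry. -/
def tail : PR 1 := comp snd ![pred]

/-- `drop (i, x)`: the sequence `x` without its first `i` entries. -/
def drop : PR 2 := prec (proj 0) (comp tail ![proj 1])

/-- `nth (x, i) = (x)_i`, the entry of `x` with index `i`. -/
def nth : PR 2 := comp head ![comp drop ![proj 1, proj 0]]

/-- The length of `x`: the number of `i < x` such that `drop (i, x)` is not empty. -/
def len : PR 1 :=
  comp (prec (null : PR 1) (comp add ![proj 1,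
    comp sub ![one, comp sub ![one, comp drop ![proj 0, proj 2]]]])) ![proj 0, proj 0]

/-- Concatenation `x ⋆ y`: put the entries of `x`, from the last one to the first one,
in front of `y`. -/
def cat : PR 2 :=
  comp (prec (proj 1) (comp cons
    ![comp nth ![proj 2, comp sub ![comp len ![proj 2], comp succ ![proj 0]]], proj 1]))
    ![comp len ![proj 0], proj 0, proj 1]

end PR

/-! ### Two-sorted languages -/

/-- A language extends the basic one (numbers, names of primitive recursive functions, choice
sequence variables) by function symbols `Sym k l` with `k` number arguments and `l` choice
sequence arguments and, if `Box` holds, by the operators `□_t`. -/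
structure Lang where
  Sym : ℕ → ℕ → Type
  Box : Prop

/-- Number terms, with number variables in `Fin n` and choice sequence variables in `Fin m`. -/
inductive Tm (L : Lang) (n m : ℕ) : Type
  | var (i : Fin n) : Tm L n m
  | app (a : Fin m) (t : Tm L n m) : Tm L n m
  | pr {k : ℕ} (f : PR k) (ts : Fin k → Tm L n m) : Tm L n m
  | sym {k l : ℕ} (s : L.Sym k l) (ts : Fin k → Tm L n m) (as : Fin l → Fin m) : Tm L n m

/-- Formulas with free number variables in `Fin n` and free choice sequence variables in
`Fin m`. A quantifier binds the variable with index `0` and shifts the others. -/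
inductive Fm (L : Lang) : ℕ → ℕ → Type
  | eq {n m : ℕ} (t s : Tm L n m) : Fm L n m
  | bot {n m : ℕ} : Fm L n m
  | and {n m : ℕ} (A B : Fm L n m) : Fm L n m
  | or {n m : ℕ} (A B : Fm L n m) : Fm L n m
  | imp {n m : ℕ} (A B : Fm L n m) : Fm L n m
  | allN {n m : ℕ} (A : Fm L (n + 1) m) : Fm L n m
  | exN {n m : ℕ} (A : Fm L (n + 1) m) : Fm L n m
  | allF {n m : ℕ} (A : Fm L n (m + 1)) : Fm L n m
  | exF {n m : ℕ} (A : Fm L n (m + 1)) : Fm L n m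
  | box {n m : ℕ} (h : L.Box) (t : Tm L n m) (A : Fm L n m) : Fm L n m

/-- Sentences. -/
abbrev Sentence (L : Lang) : Type := Fm L 0 0

/-! ### Substitution -/

/-- Simultaneous substitution of terms for number variables and of choice sequence variables
for choice sequence variables. -/
def Tm.subst {L : Lang} {n m n' m' : ℕ} (σ : Fin n → Tm L n' m') (ρ : Fin m → Fin m') :
    Tm L n m → Tm L n' m'
  | .var i => σ i
  | .app a t => .app (ρ a) (t.subst σ ρ)
  | .pr f ts => .pr f (fun i => (ts i).subst σ ρ)
  | .sym s ts as => .sym s (fun i => (ts i).subst σ ρ) (fun j => ρ (as j))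

/-- Add a fresh number variable with index `0`. -/
def Tm.wkN {L : Lang} {n m : ℕ} (t : Tm L n m) : Tm L (n + 1) m :=
  t.subst (fun i => .var i.succ) id

/-- Add a fresh choice sequence variable with index `0`. -/
def Tm.wkF {L : Lang} {n m : ℕ} (t : Tm L n m) : Tm L n (m + 1) :=
  t.subst .var Fin.succ

/-- A substitution under a number quantifier. -/
def upN {L : Lang} {n n' m' : ℕ} (σ : Fin n → Tm L n' m') : Fin (n + 1) → Tm L (n' + 1) m' :=
  Fin.cases (.var 0) (fun i => (σ i).wkN)

/-- A renaming under a choice sequence quantifier. -/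
def upF {m m' : ℕ} (ρ : Fin m → Fin m') : Fin (m + 1) → Fin (m' + 1) :=
  Fin.cases 0 (fun i => (ρ i).succ)

/-- Simultaneous (capture avoiding) substitution in formulas. -/
def Fm.subst {L : Lang} : {n m n' m' : ℕ} → (Fin n → Tm L n' m') → (Fin m → Fin m') →
    Fm L n m → Fm L n' m'
  | _, _, _, _, σ, ρ, .eq t s => .eq (t.subst σ ρ) (s.subst σ ρ)
  | _, _, _, _, _, _, .bot => .bot
  | _, _, _, _, σ, ρ, .and A B => .and (A.subst σ ρ) (B.subst σ ρ)
  | _, _, _, _, σ, ρ, .or A B => .or (A.subst σ ρ) (B.subst σ ρ)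
  | _, _, _, _, σ, ρ, .imp A B => .imp (A.subst σ ρ) (B.subst σ ρ)
  | _, _, _, _, σ, ρ, .allN A => .allN (A.subst (upN σ) ρ)
  | _, _, _, _, σ, ρ, .exN A => .exN (A.subst (upN σ) ρ)
  | _, _, _, _, σ, ρ, .allF A => .allF (A.subst (fun i => (σ i).wkF) (upF ρ))
  | _, _, _, _, σ, ρ, .exF A => .exF (A.subst (fun i => (σ i).wkF) (upF ρ))
  | _, _, _, _, σ, ρ, .box h t A => .box h (t.subst σ ρ) (A.subst σ ρ)

namespace Fm

variable {L : Lang} {n m : ℕ}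

/-- Add a fresh number variable with index `0`. -/
def wkN (A : Fm L n m) : Fm L (n + 1) m := A.subst (fun i => .var i.succ) id

/-- Add a fresh choice sequence variable with index `0`. -/
def wkF (A : Fm L n m) : Fm L n (m + 1) := A.subst .var Fin.succ

/-- Substitute `t` for the number variable with index `0`. -/
def instN (A : Fm L (n + 1) m) (t : Tm L n m) : Fm L n m := A.subst (Fin.cases t .var) id

/-- Substitute `a` for the choice sequence variable with index `0`. -/
def instF (A : Fm L n (m + 1)) (a : Fin m) : Fm L n m := A.subst .var (Fin.cases a id)

/-- A sentence, seen as a formula in any variables. -/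
def ofSentence (A : Sentence L) : Fm L n m := A.subst Fin.elim0 Fin.elim0

/-- Negation. -/
def neg (A : Fm L n m) : Fm L n m := .imp A .bot

/-- Equivalence. -/
def iff (A B : Fm L n m) : Fm L n m := .and (.imp A B) (.imp B A)

/-- The universal closure. -/
def closure : {n m : ℕ} → Fm L n m → Sentence L
  | 0, 0, A => A
  | 0, _ + 1, A => closure (.allF A)
  | _ + 1, _, A => closure (.allN A)

end Fm

/-! ### Translation along an extension of languages -/

/-- Rename the additional function symbols of a term. -/
def Tm.map {L L' : Lang} (s : ∀ k l : ℕ, L.Sym k l → L'.Sym k l) {n m : ℕ} :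
    Tm L n m → Tm L' n m
  | .var i => .var i
  | .app a t => .app a (t.map s)
  | .pr f ts => .pr f (fun i => (ts i).map s)
  | .sym c ts as => .sym (s _ _ c) (fun i => (ts i).map s) as

/-- Read a formula of one language as a formula of a larger one. -/
def Fm.map {L L' : Lang} (s : ∀ k l : ℕ, L.Sym k l → L'.Sym k l) (b : L.Box → L'.Box) :
    {n m : ℕ} → Fm L n m → Fm L' n m
  | _, _, .eq t u => .eq (t.map s) (u.map s)
  | _, _, .bot => .bot
  | _, _, .and A B => .and (A.map s b) (B.map s b)
  | _, _, .or A B => .or (A.map s b) (B.map s b)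
  | _, _, .imp A B => .imp (A.map s b) (B.map s b)
  | _, _, .allN A => .allN (A.map s b)
  | _, _, .exN A => .exN (A.map s b)
  | _, _, .allF A => .allF (A.map s b)
  | _, _, .exF A => .exF (A.map s b)
  | _, _, .box h t A => .box (b h) (t.map s) (A.map s b)

/-! ### Two-sorted intuitionistic predicate logic with equality of numbers -/

/-- A theory is given by its axioms. -/
abbrev Theory (L : Lang) : Type := Set (Sentence L)

/-- Natural deduction: `Prov T Γ A` says that `A` is derivable from the axioms of `T` and the
assumptions in `Γ` in intuitionistic two-sorted predicate logic with equality of numbers. -/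
inductive Prov {L : Lang} (T : Theory L) : {n m : ℕ} → List (Fm L n m) → Fm L n m → Prop
  | ax {n m : ℕ} {Γ : List (Fm L n m)} {A : Sentence L} (h : A ∈ T) :
      Prov T Γ (Fm.ofSentence A)
  | hyp {n m : ℕ} {Γ : List (Fm L n m)} {A : Fm L n m} (h : A ∈ Γ) : Prov T Γ A
  | botE {n m : ℕ} {Γ : List (Fm L n m)} {A : Fm L n m} (h : Prov T Γ .bot) : Prov T Γ A
  | andI {n m : ℕ} {Γ : List (Fm L n m)} {A B : Fm L n m}
      (h₁ : Prov T Γ A) (h₂ : Prov T Γ B) : Prov T Γ (.and A B)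
  | andE₁ {n m : ℕ} {Γ : List (Fm L n m)} {A B : Fm L n m}
      (h : Prov T Γ (.and A B)) : Prov T Γ A
  | andE₂ {n m : ℕ} {Γ : List (Fm L n m)} {A B : Fm L n m}
      (h : Prov T Γ (.and A B)) : Prov T Γ B
  | orI₁ {n m : ℕ} {Γ : List (Fm L n m)} {A B : Fm L n m}
      (h : Prov T Γ A) : Prov T Γ (.or A B)
  | orI₂ {n m : ℕ} {Γ : List (Fm L n m)} {A B : Fm L n m}
      (h : Prov T Γ B) : Prov T Γ (.or A B)
  | orE {n m : ℕ} {Γ : List (Fm L n m)} {A B C : Fm L n m} (h : Prov T Γ (.or A B))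
      (h₁ : Prov T (A :: Γ) C) (h₂ : Prov T (B :: Γ) C) : Prov T Γ C
  | impI {n m : ℕ} {Γ : List (Fm L n m)} {A B : Fm L n m}
      (h : Prov T (A :: Γ) B) : Prov T Γ (.imp A B)
  | impE {n m : ℕ} {Γ : List (Fm L n m)} {A B : Fm L n m}
      (h₁ : Prov T Γ (.imp A B)) (h₂ : Prov T Γ A) : Prov T Γ B
  | allNI {n m : ℕ} {Γ : List (Fm L n m)} {A : Fm L (n + 1) m}
      (h : Prov T (Γ.map Fm.wkN) A) : Prov T Γ (.allN A)
  | allNE {n m : ℕ} {Γ : List (Fm L n m)} {A : Fm L (n + 1) m}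
      (h : Prov T Γ (.allN A)) (t : Tm L n m) : Prov T Γ (A.instN t)
  | exNI {n m : ℕ} {Γ : List (Fm L n m)} {A : Fm L (n + 1) m}
      (t : Tm L n m) (h : Prov T Γ (A.instN t)) : Prov T Γ (.exN A)
  | exNE {n m : ℕ} {Γ : List (Fm L n m)} {A : Fm L (n + 1) m} {C : Fm L n m}
      (h : Prov T Γ (.exN A)) (h₁ : Prov T (A :: Γ.map Fm.wkN) C.wkN) : Prov T Γ C
  | allFI {n m : ℕ} {Γ : List (Fm L n m)} {A : Fm L n (m + 1)}
      (h : Prov T (Γ.map Fm.wkF) A) : Prov T Γ (.allF A)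
  | allFE {n m : ℕ} {Γ : List (Fm L n m)} {A : Fm L n (m + 1)}
      (h : Prov T Γ (.allF A)) (a : Fin m) : Prov T Γ (A.instF a)
  | exFI {n m : ℕ} {Γ : List (Fm L n m)} {A : Fm L n (m + 1)}
      (a : Fin m) (h : Prov T Γ (A.instF a)) : Prov T Γ (.exF A)
  | exFE {n m : ℕ} {Γ : List (Fm L n m)} {A : Fm L n (m + 1)} {C : Fm L n m}
      (h : Prov T Γ (.exF A)) (h₁ : Prov T (A :: Γ.map Fm.wkF) C.wkF) : Prov T Γ C
  | eqI {n m : ℕ} {Γ : List (Fm L n m)} (t : Tm L n m) : Prov T Γ (.eq t t)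
  | eqE {n m : ℕ} {Γ : List (Fm L n m)} {t s : Tm L n m} (A : Fm L (n + 1) m)
      (h : Prov T Γ (.eq t s)) (h₁ : Prov T Γ (A.instN t)) : Prov T Γ (A.instN s)

/-- The theory `T` proves the sentence `A`. -/
def Proves {L : Lang} (T : Theory L) (A : Sentence L) : Prop := Prov T [] A

/-- The theory `T` is consistent. -/
def Consistent {L : Lang} (T : Theory L) : Prop := ¬ Proves T .bot

/-! ### Abbreviations of the language of analysis -/

section Abbreviations

variable {L : Lang} {n m : ℕ}

/-- The term `0`, which is also the code of the empty sequence. -/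
def zeroT : Tm L n m := .pr .zero ![]

/-- The term `t + 1`. -/
def succT (t : Tm L n m) : Tm L n m := .pr .succ ![t]

/-- The code of the sequence `t` followed by the sequence coded by `s`, i.e. `⟨t⟩ ⋆ s`. -/
def consT (t s : Tm L n m) : Tm L n m := .pr .cons ![t, s]

/-- The term `t ⋆ s`. -/
def catT (t s : Tm L n m) : Tm L n m := .pr .cat ![t, s]

/-- `t < s`, as `∃ z, (z + 1) + t = s`. -/
def ltF (t s : Tm L n m) : Fm L n m :=
  .exN (.eq (.pr .add ![succT (.var 0), t.wkN]) s.wkN)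

/-- `w = b̄(x)`, that is, `w = ⟨b(0), …, b(x - 1)⟩`. -/
def barF (b : Fin m) (x w : Tm L n m) : Fm L n m :=
  .and (.eq (.pr .len ![w]) x)
    (.allN (.imp (ltF (.var 0) x.wkN) (.eq (.pr .nth ![w.wkN, .var 0]) (.app b (.var 0)))))

/-- `a ∈ K₀`, that is,
`∀ x y, (a(x) ≠ 0 → a(x ⋆ y) = a(x)) ∧ ∀ β, ∃ x, a(β̄(x)) ≠ 0`. -/
def inK0 (a : Fin m) : Fm L n m :=
  .and
    (.allN (.allN (.imp (.neg (.eq (.app a (.var 1)) zeroT))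
      (.eq (.app a (catT (.var 1) (.var 0))) (.app a (.var 1))))))
    (.allF (.exN (.exN (.and (barF 0 (.var 1) (.var 0))
      (.neg (.eq (.app a.succ (.var 0)) zeroT))))))

/-- `y = c(b)` for a continuous functional `c`, that is, `∃ z, y + 1 = c(b̄(z))`. -/
def valF (c b : Fin m) (y : Tm L n m) : Fm L n m :=
  .exN (.exN (.and (barF b (.var 1) (.var 0)) (.eq (succT y.wkN.wkN) (.app c (.var 0)))))

/-- `c | a = b`, that is, `∀ x ∃ z, b(x) + 1 = c(⟨x⟩ ⋆ ā(z))`. -/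
def mapF (c a b : Fin m) : Fm L n m :=
  .allN (.exN (.exN (.and (barF a (.var 1) (.var 0))
    (.eq (succT (.app b (.var 2))) (.app c (consT (.var 2) (.var 0)))))))

end Abbreviations

/-! ### Axioms of analysis -/

/-- The arithmetical axioms, with induction for all formulas of the language. -/
inductive PrAn1 (L : Lang) : Theory L
  | succ_ne_zero : PrAn1 L (Fm.closure (n := 1) (m := 0) (.neg (.eq (succT (.var 0)) zeroT)))
  | succ_inj : PrAn1 L (Fm.closure (n := 2) (m := 0)
      (.imp (.eq (succT (.var 0)) (succT (.var 1))) (.eq (.var 0) (.var 1))))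
  | induction {n m : ℕ} (A : Fm L (n + 1) m) : PrAn1 L (Fm.closure
      (.imp (.and (A.instN zeroT)
          (.allN (.imp A (A.subst (Fin.cases (succT (.var 0)) (fun i => .var i.succ)) id))))
        (.allN A)))
  | identity : PrAn1 L (Fm.closure (n := 2) (m := 1)
      (.imp (.eq (.var 0) (.var 1)) (.eq (.app 0 (.var 0)) (.app 0 (.var 1)))))
  | proj {k : ℕ} (i : Fin k) : PrAn1 L (Fm.closure (n := k) (m := 0)
      (.eq (.pr (.proj i) .var) (.var i)))
  | comp {j k : ℕ} (f : PR j) (g : Fin j → PR k) : PrAn1 L (Fm.closure (n := k) (m := 0)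
      (.eq (.pr (.comp f g) .var) (.pr f (fun i => .pr (g i) .var))))
  | prec_zero {k : ℕ} (f : PR k) (g : PR (k + 2)) : PrAn1 L (Fm.closure (n := k) (m := 0)
      (.eq (.pr (.prec f g) (Fin.cons zeroT .var)) (.pr f .var)))
  | prec_succ {k : ℕ} (f : PR k) (g : PR (k + 2)) : PrAn1 L (Fm.closure (n := k + 1) (m := 0)
      (.eq (.pr (.prec f g) (Fin.cons (succT (.var 0)) (fun i => .var i.succ)))
        (.pr g (Fin.cons (.var 0) (Fin.cons (.pr (.prec f g) .var) (fun i => .var i.succ))))))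

/-- The comprehension scheme `∃ α ∀ x, α(x) = t(x)` for all terms `t` of the language. -/
inductive PrAn2 (L : Lang) : Theory L
  | mk {n m : ℕ} (t : Tm L (n + 1) m) : PrAn2 L (Fm.closure
      (.exF (.allN (.eq (.app 0 (.var 0)) t.wkF))))

/-- Continuity for numbers: `∀ α ∃ x A(α, x) → ∃ γ ∈ K₀ ∀ α A(α, γ(α))`. As `γ(α)` is defined
for all `γ ∈ K₀`, the formula `A(α, γ(α))` is written as `∀ x, (x = γ(α) → A(α, x))`. -/
inductive BCN (L : Lang) : Theory L
  | mk {n m : ℕ} (A : Fm L (n + 1) (m + 1)) : BCN L (Fm.closure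
      (.imp (.allF (.exN A))
        (.exF (.and (inK0 0)
          (.allF (.allN (.imp (valF 1 0 (.var 0)) (A.subst .var (upF Fin.succ)))))))))

/-- Continuity for functions: `∀ α ∃ β A(α, β) → ∃ γ ∈ K₀ ∀ α A(α, γ | α)`, with
`A(α, γ | α)` written as `∃ β, (γ | α = β ∧ A(α, β))`. -/
inductive BCC (L : Lang) : Theory L
  | mk {n m : ℕ} (A : Fm L n (m + 2)) : BCC L (Fm.closure
      (.imp (.allF (.exF A))
        (.exF (.and (inK0 0)
          (.allF (.exF (.and (mapF 2 1 0) (A.subst .var (upF (upF Fin.succ))))))))))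

/-- Countable choice: `∀ x ∃ α A(x, α) → ∃ β ∀ x A(x, λ y. β(pair(x, y)))`. -/
inductive ACNF (L : Lang) : Theory L
  | mk {n m : ℕ} (A : Fm L (n + 1) (m + 1)) : ACNF L (Fm.closure
      (.imp (.allN (.exF A))
        (.exF (.allN (.exF (.and
          (.allN (.eq (.app 0 (.var 0)) (.app 1 (.pr .pair ![.var 1, .var 0]))))
          (A.subst .var (upF Fin.succ))))))))

/-- Bar induction: from `∀ α ∃ x R(ᾱ(x))`, `∀ a (R(a) ∨ ¬ R(a))`, `∀ a (R(a) → A(a))` and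
`∀ a (∀ s A(a ⋆ ⟨s⟩) → A(a))` conclude `A(⟨⟩)`. -/
inductive BI (L : Lang) : Theory L
  | mk {n m : ℕ} (R A : Fm L (n + 1) m) : BI L (Fm.closure
      (.imp (.and
          (.allF (.exN (.exN (.and (barF 0 (.var 1) (.var 0))
            (R.subst (Fin.cases (.var 0) (fun i => .var i.succ.succ)) Fin.succ)))))
        (.and (.allN (.or R (.neg R)))
        (.and (.allN (.imp R A))
          (.allN (.imp
            (.allN (A.subst (Fin.cases (catT (.var 1) (consT (.var 0) zeroT))
              (fun i => .var i.succ.succ)) id))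
            A)))))
        (A.instN zeroT)))

/-! ### Intuitionistic analysis -/

/-- The language of intuitionistic analysis. -/
def L₀ : Lang := ⟨fun _ _ => Empty, False⟩

/-- The theory `FIM₀`. -/
def FIM₀ : Theory L₀ := PrAn1 L₀ ∪ PrAn2 L₀ ∪ BCN L₀

/-- The theory `FIM` of Kleene and Vesley: `FIM₀` with countable choice, bar induction and
continuity for functions. -/
def FIM : Theory L₀ := FIM₀ ∪ ACNF L₀ ∪ BI L₀ ∪ BCC L₀

/-- The sentence `∀ α (¬¬ ∃ x, α(x) = 0 → ∃ x, α(x) = 0)`. -/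
def GMP : Sentence L₀ :=
  .allF (.imp (.neg (.neg (.exN (.eq (.app 0 (.var 0)) zeroT))))
    (.exN (.eq (.app 0 (.var 0)) zeroT)))

/-! ### The creating subject -/

/-- The language of intuitionistic analysis with the operators `□_t`. -/
def LBox : Lang := ⟨fun _ _ => Empty, True⟩

/-- The extended `Δ⁰₀` formulas: they are built by propositional connectives and bounded number
quantifiers from equations and formulas `□_x B` where `x` is a number variable and `B` has no
free number variables (it may have free choice sequence variables). -/
inductive ExtDelta : {n m : ℕ} → Fm LBox n m → Prop
  | eq {n m : ℕ} (t s : Tm LBox n m) : ExtDelta (.eq t s)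
  | box {n m : ℕ} (i : Fin n) (B : Fm LBox 0 m) :
      ExtDelta (.box trivial (.var i) (B.subst Fin.elim0 id))
  | bot {n m : ℕ} : ExtDelta (.bot : Fm LBox n m)
  | and {n m : ℕ} {A B : Fm LBox n m} (hA : ExtDelta A) (hB : ExtDelta B) : ExtDelta (.and A B)
  | or {n m : ℕ} {A B : Fm LBox n m} (hA : ExtDelta A) (hB : ExtDelta B) : ExtDelta (.or A B)
  | imp {n m : ℕ} {A B : Fm LBox n m} (hA : ExtDelta A) (hB : ExtDelta B) : ExtDelta (.imp A B)
  | allB {n m : ℕ} (t : Tm LBox n m) {A : Fm LBox (n + 1) m} (hA : ExtDelta A) :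
      ExtDelta (.allN (.imp (ltF (.var 0) t.wkN) A))
  | exB {n m : ℕ} (t : Tm LBox n m) {A : Fm LBox (n + 1) m} (hA : ExtDelta A) :
      ExtDelta (.exN (.and (ltF (.var 0) t.wkN) A))

/-- The Kreiselian language: the language of analysis with the operators `□_t` and a function
symbol `χ_A` for each extended `Δ⁰₀` formula `A`. The arguments of `χ_A` are the number
variables and the choice sequence variables of `A`. -/
def LK : Lang := ⟨fun k l => {A : Fm LBox k l // ExtDelta A}, True⟩

/-- A formula of analysis as a formula of the Kreiselian language. -/
def Fm.toLK {n m : ℕ} (A : Fm L₀ n m) : Fm LK n m :=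
  A.map (fun _ _ s => Empty.elim s) False.elim

/-- A formula of analysis with boxes as a formula of the Kreiselian language. -/
def Fm.boxToLK {n m : ℕ} (A : Fm LBox n m) : Fm LK n m :=
  A.map (fun _ _ s => Empty.elim s) (fun _ => trivial)

/-- The formula `□_t A`. -/
def boxF {n m : ℕ} (t : Tm LK n m) (A : Fm LK n m) : Fm LK n m := .box trivial t A

/-- The axioms `(χ_A = 1 ↔ A) ∧ (χ_A = 0 ↔ ¬ A)` for the characteristic functions. -/
inductive ChiAx : Theory LK
  | mk {k l : ℕ} (A : Fm LBox k l) (hA : ExtDelta A) : ChiAx (Fm.closure (L := LK)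
      (.and
        (.iff (.eq (.sym (L := LK) ⟨A, hA⟩ .var id) (succT zeroT)) A.boxToLK)
        (.iff (.eq (.sym (L := LK) ⟨A, hA⟩ .var id) zeroT) (.neg A.boxToLK))))

/-- The theory `FIM₀⁺`: induction and comprehension are extended to the Kreiselian language,
continuity is not. -/
def FIM₀plus : Theory LK := PrAn1 LK ∪ ChiAx ∪ PrAn2 LK ∪ Fm.toLK '' BCN L₀

/-- The axioms for the creating subject, for all formulas of the Kreiselian language. -/
inductive CS : Theory LK
  | cs1 {n m : ℕ} (A : Fm LK n m) : CS (Fm.closure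
      (.allN (.or (boxF (.var 0) A.wkN) (.neg (boxF (.var 0) A.wkN)))))
  | cs2 {n m : ℕ} (A : Fm LK n m) : CS (Fm.closure
      (.imp A (.neg (.neg (.exN (boxF (.var 0) A.wkN))))))
  | cs3 {n m : ℕ} (A : Fm LK n m) : CS (Fm.closure
      (.imp (.exN (boxF (.var 0) A.wkN)) A))

/-! ### Extensions -/

/-- `T'` is an extension of `T`: it proves all theorems of `T`. -/
def IsExtension (T' : Theory LK) (T : Theory L₀) : Prop :=
  ∀ A : Sentence L₀, Proves T A → Proves T' A.toLK

/-- `T'` is conservative over `T`: a sentence of the language of `T` that is provable in `T'`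
is provable in `T`. -/
def IsConservative (T' : Theory LK) (T : Theory L₀) : Prop :=
  ∀ A : Sentence L₀, Proves T' A.toLK → Proves T A

end CreatingSubject

/-!
Two things have to be shown: the theory of the creating subject refutes Markov's principle `GMP`,
and `GMP` is consistent with intuitionistic analysis. Together they make the sentence `¬ GMP` a
witness against conservativity, over `FIM₀` and over `FIM`. That the theory extends `FIM₀` holds
because reading a derivation in the larger language gives a derivation
(`FIM₀.isExtension`).

**The creating subject refutes `GMP`** (`TCS_proves_not_GMP`). Let `A(α)` say that the sequence `α`
is zero or not zero. As `¬¬ A(α)` is provable, so is `¬¬ ∃ n, □_n A(α)`. By comprehension for the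
characteristic function of `¬ □_n A(α)`, the stages `n` with `□_n A(α)` are the zeros of a choice
sequence, so `GMP` gives such a stage, and hence `A(α)`. But `∀ α, A(α)` contradicts continuity: a
continuous functional that recognizes the zero sequence depends on an initial segment of it only,
and cannot tell it from a sequence which differs from it later.

**`FIM + GMP` is consistent** (`consistent_insert_GMP_FIM`). Formulas are interpreted in the
sheaves over the monoid of continuous functions `f` from Baire space to itself, with countable
clopen partitions as covers: number variables stand for continuous functions to `ℕ`, sequence
variables for continuous functions to Baire space, and an implication is forced if it is preserved
by composition with every `f`. Three features of Baire space make this a model.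

* It is homeomorphic to `ℕ × Baire` and to its own square, so a statement `∀ x ∃ α` or
  `∀ α ∃ β` is witnessed by a single continuous function of the parameter and of `x` or `α`. This
  gives countable choice, and the two continuity schemes because a continuous functional has an
  associate that depends continuously on the parameter (`exists_associate`).
* The constant functions are among the `f`. So a negation of an equation is forced if and only if
  it is true at every point, and `¬¬ ∃ x, α(x) = 0` says that `α` has a zero at every point. The
  least zero is a continuous function of the point, so `GMP` is forced.
* It is complete: a descending sequence of cylinders has a common point. If bar induction fails,
  then a sequence of extensions of the parameter and of the argument along which it keeps failing
  has a limit, where the bar is missed (`BI.forces`).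
-/

namespace CreatingSubject

/-! ### Substitution and derivations -/

section Substitution

variable {L : Lang} {n m n' m' n'' m'' : ℕ}

theorem Tm.subst_subst (σ : Fin n → Tm L n' m') (ρ : Fin m → Fin m')
    (σ' : Fin n' → Tm L n'' m'') (ρ' : Fin m' → Fin m'') (t : Tm L n m) :
    (t.subst σ ρ).subst σ' ρ' = t.subst (fun i => (σ i).subst σ' ρ') (fun j => ρ' (ρ j)) := by
  induction t with
  | var i => rfl
  | app a t ih => simp only [Tm.subst, ih]
  | pr f ts ih => simp only [Tm.subst, ih]
  | sym s ts as ih => simp only [Tm.subst, ih]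

theorem Tm.subst_var (t : Tm L n m) : t.subst .var id = t := by
  induction t with
  | var i => rfl
  | app a t ih => simp only [Tm.subst, ih, id]
  | pr f ts ih => simp only [Tm.subst, ih]
  | sym s ts as ih => simp only [Tm.subst, ih, id]

theorem subst_upN (σ : Fin n → Tm L n' m') (σ' : Fin n' → Tm L n'' m'') (ρ' : Fin m' → Fin m'') :
    (fun i => (upN σ i).subst (upN σ') ρ') = upN (fun i => (σ i).subst σ' ρ') := by
  funext i
  refine Fin.cases rfl (fun i => ?_) i
  simp only [upN, Fin.cases_succ, Tm.wkN, Tm.subst_subst, Tm.subst, id]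

theorem subst_wkF (σ : Fin n → Tm L n' m') (σ' : Fin n' → Tm L n'' m'') (ρ' : Fin m' → Fin m'') :
    (fun i => (σ i).wkF.subst (fun i => (σ' i).wkF) (upF ρ')) =
      fun i => ((σ i).subst σ' ρ').wkF := by
  funext i
  simp only [Tm.wkF, Tm.subst_subst, Tm.subst, upF, Fin.cases_succ]

theorem upF_comp (ρ : Fin m → Fin m') (ρ' : Fin m' → Fin m'') :
    (fun j => upF ρ' (upF ρ j)) = upF (fun j => ρ' (ρ j)) := by
  funext j
  exact Fin.cases rfl (fun j => rfl) j

theorem Fm.subst_subst (A : Fm L n m) : ∀ {n' m' n'' m'' : ℕ} (σ : Fin n → Tm L n' m')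
    (ρ : Fin m → Fin m') (σ' : Fin n' → Tm L n'' m'') (ρ' : Fin m' → Fin m''),
    (A.subst σ ρ).subst σ' ρ' = A.subst (fun i => (σ i).subst σ' ρ') (fun j => ρ' (ρ j)) := by
  induction A <;> intro n' m' n'' m'' σ ρ σ' ρ' <;>
    simp only [Fm.subst, Tm.subst_subst, subst_upN, subst_wkF, upF_comp, *]

theorem upN_var : upN (.var : Fin n → Tm L n m) = .var := by
  funext i
  exact Fin.cases rfl (fun i => rfl) i

theorem upF_id : upF (id : Fin m → Fin m) = id := by
  funext i
  exact Fin.cases rfl (fun i => rfl) i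

theorem Fm.subst_var (A : Fm L n m) : A.subst .var id = A := by
  induction A with
  | allN A ih | exN A ih => simp only [Fm.subst, upN_var, ih]
  | allF A ih | exF A ih =>
    simp only [Fm.subst, upF_id]
    exact congrArg _ ih
  | _ => simp only [Fm.subst, Tm.subst_var, *]

theorem Fm.subst_ofSentence (A : Sentence L) (σ : Fin n → Tm L n' m') (ρ : Fin m → Fin m') :
    (Fm.ofSentence A : Fm L n m).subst σ ρ = Fm.ofSentence A := by
  simp only [Fm.ofSentence, Fm.subst_subst]
  congr 1 <;> exact funext fun i => i.elim0

theorem Fm.ofSentence_self (A : Sentence L) : (Fm.ofSentence A : Sentence L) = A := by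
  conv_rhs => rw [← A.subst_var]
  simp only [Fm.ofSentence]
  congr 1 <;> exact funext fun i => i.elim0

theorem Fm.wkN_subst (A : Fm L n m) (σ : Fin n → Tm L n' m') (ρ : Fin m → Fin m') :
    A.wkN.subst (upN σ) ρ = (A.subst σ ρ).wkN := by
  simp only [Fm.wkN, Fm.subst_subst]; rfl

theorem Fm.wkF_subst (A : Fm L n m) (σ : Fin n → Tm L n' m') (ρ : Fin m → Fin m') :
    A.wkF.subst (fun i => (σ i).wkF) (upF ρ) = (A.subst σ ρ).wkF := by
  simp only [Fm.wkF, Fm.subst_subst]; rfl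

theorem Tm.wkN_subst_cases (s : Tm L n m) (t : Tm L n m) :
    s.wkN.subst (Fin.cases t .var) id = s := by
  conv_rhs => rw [← s.subst_var]
  simp only [Tm.wkN, Tm.subst_subst]; rfl

theorem Tm.wkF_subst_cases (s : Tm L n m) (a : Fin m) :
    s.wkF.subst .var (Fin.cases a id) = s := by
  conv_rhs => rw [← s.subst_var]
  simp only [Tm.wkF, Tm.subst_subst]; rfl

theorem Fm.instN_subst (A : Fm L (n + 1) m) (t : Tm L n m) (σ : Fin n → Tm L n' m')
    (ρ : Fin m → Fin m') :
    (A.instN t).subst σ ρ = (A.subst (upN σ) ρ).instN (t.subst σ ρ) := by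
  simp only [Fm.instN, Fm.subst_subst]
  congr 1
  funext i
  refine Fin.cases rfl (fun i => ?_) i
  simp only [Fin.cases_succ, Tm.subst, upN, Tm.wkN_subst_cases]

theorem Fm.instF_subst (A : Fm L n (m + 1)) (a : Fin m) (σ : Fin n → Tm L n' m')
    (ρ : Fin m → Fin m') :
    (A.instF a).subst σ ρ = (A.subst (fun i => (σ i).wkF) (upF ρ)).instF (ρ a) := by
  simp only [Fm.instF, Fm.subst_subst]
  congr 1
  · funext i
    simp only [Tm.subst, Tm.wkF_subst_cases]
  · funext j
    exact Fin.cases rfl (fun i => rfl) j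

end Substitution

theorem Fm.closure_zero {L : Lang} (A : Sentence L) : A.closure = A := by
  rw [Fm.closure]

theorem Fm.closure_allF {L : Lang} {m : ℕ} (A : Fm L 0 (m + 1)) :
    A.closure = (Fm.allF A).closure := by
  rw [Fm.closure]

theorem Fm.closure_allN {L : Lang} {n m : ℕ} (A : Fm L (n + 1) m) :
    A.closure = (Fm.allN A).closure := by
  rw [Fm.closure]

section Derivations

variable {L : Lang} {T T' : Theory L} {n m : ℕ}

theorem Prov.mono (hT : T ⊆ T') {Γ : List (Fm L n m)} {A : Fm L n m} (h : Prov T Γ A) :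
    Prov T' Γ A := by
  induction h with
  | ax h => exact .ax (hT h)
  | hyp h => exact .hyp h
  | botE _ ih => exact .botE ih
  | andI _ _ ih₁ ih₂ => exact .andI ih₁ ih₂
  | andE₁ _ ih => exact .andE₁ ih
  | andE₂ _ ih => exact .andE₂ ih
  | orI₁ _ ih => exact .orI₁ ih
  | orI₂ _ ih => exact .orI₂ ih
  | orE _ _ _ ih ih₁ ih₂ => exact .orE ih ih₁ ih₂
  | impI _ ih => exact .impI ih
  | impE _ _ ih₁ ih₂ => exact .impE ih₁ ih₂
  | allNI _ ih => exact .allNI ih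
  | allNE _ t ih => exact .allNE ih t
  | exNI t _ ih => exact .exNI t ih
  | exNE _ _ ih ih₁ => exact .exNE ih ih₁
  | allFI _ ih => exact .allFI ih
  | allFE _ a ih => exact .allFE ih a
  | exFI a _ ih => exact .exFI a ih
  | exFE _ _ ih ih₁ => exact .exFE ih ih₁
  | eqI t => exact .eqI t
  | eqE A _ _ ih ih₁ => exact .eqE A ih ih₁

/-- Derivations are closed under substitution and under adding assumptions. -/
theorem Prov.subst {Γ : List (Fm L n m)} {A : Fm L n m} (h : Prov T Γ A) :
    ∀ {n' m' : ℕ} {Δ : List (Fm L n' m')} (σ : Fin n → Tm L n' m') (ρ : Fin m → Fin m'),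
      (∀ B ∈ Γ, B.subst σ ρ ∈ Δ) → Prov T Δ (A.subst σ ρ) := by
  -- the assumptions of a premise with one more assumption `B`
  have cons {n m n' m' : ℕ} {Γ : List (Fm L n m)} {Δ : List (Fm L n' m')}
      {σ : Fin n → Tm L n' m'} {ρ : Fin m → Fin m'} (hΓ : ∀ B ∈ Γ, B.subst σ ρ ∈ Δ)
      (A : Fm L n m) : ∀ B ∈ A :: Γ, B.subst σ ρ ∈ A.subst σ ρ :: Δ := by
    intro B hB
    rcases List.mem_cons.1 hB with rfl | hB
    · exact List.mem_cons_self
    · exact List.mem_cons_of_mem _ (hΓ B hB)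
  have wkN {n m n' m' : ℕ} {Γ : List (Fm L n m)} {Δ : List (Fm L n' m')}
      {σ : Fin n → Tm L n' m'} {ρ : Fin m → Fin m'} (hΓ : ∀ B ∈ Γ, B.subst σ ρ ∈ Δ) :
      ∀ B ∈ Γ.map Fm.wkN, B.subst (upN σ) ρ ∈ Δ.map Fm.wkN := by
    intro B hB
    obtain ⟨C, hC, rfl⟩ := List.mem_map.1 hB
    rw [Fm.wkN_subst]
    exact List.mem_map_of_mem (hΓ C hC)
  have wkF {n m n' m' : ℕ} {Γ : List (Fm L n m)} {Δ : List (Fm L n' m')}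
      {σ : Fin n → Tm L n' m'} {ρ : Fin m → Fin m'} (hΓ : ∀ B ∈ Γ, B.subst σ ρ ∈ Δ) :
      ∀ B ∈ Γ.map Fm.wkF, B.subst (fun i => (σ i).wkF) (upF ρ) ∈ Δ.map Fm.wkF := by
    intro B hB
    obtain ⟨C, hC, rfl⟩ := List.mem_map.1 hB
    rw [Fm.wkF_subst]
    exact List.mem_map_of_mem (hΓ C hC)
  induction h with
  | ax h =>
    intro n' m' Δ σ ρ hΓ
    rw [Fm.subst_ofSentence]
    exact .ax h
  | hyp h => exact fun σ ρ hΓ => .hyp (hΓ _ h)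
  | botE _ ih => exact fun σ ρ hΓ => .botE (ih σ ρ hΓ)
  | andI _ _ ih₁ ih₂ => exact fun σ ρ hΓ => .andI (ih₁ σ ρ hΓ) (ih₂ σ ρ hΓ)
  | andE₁ _ ih => exact fun σ ρ hΓ => .andE₁ (ih σ ρ hΓ)
  | andE₂ _ ih => exact fun σ ρ hΓ => .andE₂ (ih σ ρ hΓ)
  | orI₁ _ ih => exact fun σ ρ hΓ => .orI₁ (ih σ ρ hΓ)
  | orI₂ _ ih => exact fun σ ρ hΓ => .orI₂ (ih σ ρ hΓ)
  | orE _ _ _ ih ih₁ ih₂ =>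
    exact fun σ ρ hΓ => .orE (ih σ ρ hΓ) (ih₁ σ ρ (cons hΓ _)) (ih₂ σ ρ (cons hΓ _))
  | impI _ ih => exact fun σ ρ hΓ => .impI (ih σ ρ (cons hΓ _))
  | impE _ _ ih₁ ih₂ => exact fun σ ρ hΓ => .impE (ih₁ σ ρ hΓ) (ih₂ σ ρ hΓ)
  | allNI _ ih => exact fun σ ρ hΓ => .allNI (ih _ ρ (wkN hΓ))
  | allNE _ t ih =>
    intro n' m' Δ σ ρ hΓ
    rw [Fm.instN_subst]
    exact .allNE (ih σ ρ hΓ) _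
  | exNI t _ ih =>
    intro n' m' Δ σ ρ hΓ
    refine .exNI (t.subst σ ρ) ?_
    rw [← Fm.instN_subst]
    exact ih σ ρ hΓ
  | exNE _ _ ih ih₁ =>
    intro n' m' Δ σ ρ hΓ
    refine .exNE (ih σ ρ hΓ) ?_
    rw [← Fm.wkN_subst]
    exact ih₁ _ _ (cons (wkN hΓ) _)
  | allFI _ ih => exact fun σ ρ hΓ => .allFI (ih _ _ (wkF hΓ))
  | allFE _ a ih =>
    intro n' m' Δ σ ρ hΓ
    rw [Fm.instF_subst]
    exact .allFE (ih σ ρ hΓ) _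
  | exFI a _ ih =>
    intro n' m' Δ σ ρ hΓ
    refine .exFI (ρ a) ?_
    rw [← Fm.instF_subst]
    exact ih σ ρ hΓ
  | exFE _ _ ih ih₁ =>
    intro n' m' Δ σ ρ hΓ
    refine .exFE (ih σ ρ hΓ) ?_
    rw [← Fm.wkF_subst]
    exact ih₁ _ _ (cons (wkF hΓ) _)
  | eqI t => exact fun σ ρ hΓ => .eqI _
  | eqE A _ _ ih ih₁ =>
    intro n' m' Δ σ ρ hΓ
    rw [Fm.instN_subst]
    refine .eqE _ (ih σ ρ hΓ) ?_
    rw [← Fm.instN_subst]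
    exact ih₁ σ ρ hΓ

theorem Prov.weaken {Γ Δ : List (Fm L n m)} {A : Fm L n m} (h : Prov T Γ A) (hΓ : Γ ⊆ Δ) :
    Prov T Δ A := by
  have := h.subst (Δ := Δ) .var id (fun B hB => by rw [B.subst_var]; exact hΓ hB)
  rwa [A.subst_var] at this

/-- A derivable universal closure can be instantiated at once. -/
theorem Prov.of_closure {n' m' : ℕ} {Γ : List (Fm L n' m')} : ∀ {n m : ℕ} {A : Fm L n m},
    Prov T Γ (Fm.ofSentence A.closure) → ∀ (σ : Fin n → Tm L n' m') (ρ : Fin m → Fin m'),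
    Prov T Γ (A.subst σ ρ)
  | 0, 0, A, h, σ, ρ => by
    rw [Subsingleton.elim σ Fin.elim0, Subsingleton.elim ρ Fin.elim0]
    rwa [A.closure_zero] at h
  | 0, m + 1, A, h, σ, ρ => by
    rw [A.closure_allF] at h
    have h₁ := (Prov.of_closure (A := .allF A) h σ (fun j => ρ j.succ)).allFE (ρ 0)
    simp only [Fm.instF, Fm.subst_subst] at h₁
    convert h₁ using 2
    funext j
    exact Fin.cases rfl (fun j => rfl) j
  | n + 1, m, A, h, σ, ρ => by
    rw [A.closure_allN] at h
    have h₁ := (Prov.of_closure (A := .allN A) h (fun i => σ i.succ) ρ).allNE (σ 0)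
    simp only [Fm.instN, Fm.subst_subst] at h₁
    convert h₁ using 2
    · funext i
      refine Fin.cases rfl (fun i => ?_) i
      simp only [upN, Fin.cases_succ, Tm.wkN_subst_cases]
    · rfl

theorem Prov.inst {n' m' : ℕ} {Γ : List (Fm L n' m')} {A : Fm L n m} (h : A.closure ∈ T)
    (σ : Fin n → Tm L n' m') (ρ : Fin m → Fin m') : Prov T Γ (A.subst σ ρ) :=
  (Prov.ax h).of_closure σ ρ

end Derivations

/-! ### Translation of derivations -/

section Translation

variable {L L' : Lang} (s : ∀ k l : ℕ, L.Sym k l → L'.Sym k l) (b : L.Box → L'.Box) {n m : ℕ}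

theorem Tm.map_subst {n' m' : ℕ} (σ : Fin n → Tm L n' m') (ρ : Fin m → Fin m') (t : Tm L n m) :
    (t.subst σ ρ).map s = (t.map s).subst (fun i => (σ i).map s) ρ := by
  induction t with
  | var i => rfl
  | app a t ih => simp only [Tm.subst, Tm.map, ih]
  | pr f ts ih => simp only [Tm.subst, Tm.map, ih]
  | sym c ts as ih => simp only [Tm.subst, Tm.map, ih]

theorem Tm.map_wkN (t : Tm L n m) : t.wkN.map s = (t.map s).wkN := Tm.map_subst ..

theorem Tm.map_wkF (t : Tm L n m) : t.wkF.map s = (t.map s).wkF := Tm.map_subst ..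

theorem map_upN {n' m' : ℕ} (σ : Fin n → Tm L n' m') :
    (fun i => (upN σ i).map s) = upN (fun i => (σ i).map s) := by
  funext i
  refine Fin.cases rfl (fun i => ?_) i
  simp only [upN, Fin.cases_succ, Tm.map_wkN]

theorem Fm.map_subst (A : Fm L n m) : ∀ {n' m' : ℕ} (σ : Fin n → Tm L n' m')
    (ρ : Fin m → Fin m'),
    (A.subst σ ρ).map s b = (A.map s b).subst (fun i => (σ i).map s) ρ := by
  induction A <;> intro n' m' σ ρ <;>
    simp only [Fm.subst, Fm.map, Tm.map_subst, Tm.map_wkF, map_upN, *]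

theorem Fm.map_wkN (A : Fm L n m) : A.wkN.map s b = (A.map s b).wkN := Fm.map_subst ..

theorem Fm.map_wkF (A : Fm L n m) : A.wkF.map s b = (A.map s b).wkF := Fm.map_subst ..

theorem Fm.map_instN (A : Fm L (n + 1) m) (t : Tm L n m) :
    (A.instN t).map s b = (A.map s b).instN (t.map s) := by
  rw [Fm.instN, Fm.map_subst, Fm.instN]
  congr 1
  funext i
  exact Fin.cases rfl (fun i => rfl) i

theorem Fm.map_instF (A : Fm L n (m + 1)) (a : Fin m) :
    (A.instF a).map s b = (A.map s b).instF a := Fm.map_subst ..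

theorem Fm.map_ofSentence (A : Sentence L) :
    (Fm.ofSentence A : Fm L n m).map s b = Fm.ofSentence (A.map s b) := by
  rw [Fm.ofSentence, Fm.map_subst, Fm.ofSentence]
  congr 1
  exact funext fun i => i.elim0

theorem Fm.map_closure : ∀ {n m : ℕ} (A : Fm L n m), A.closure.map s b = (A.map s b).closure
  | 0, 0, A => by rw [A.closure_zero, Fm.closure_zero]
  | 0, _ + 1, A => by rw [A.closure_allF, Fm.closure_allF]; exact Fm.map_closure (.allF A)
  | _ + 1, _, A => by rw [A.closure_allN, Fm.closure_allN]; exact Fm.map_closure (.allN A)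

theorem Prov.map {T : Theory L} {T' : Theory L'} (hT : ∀ A ∈ T, A.map s b ∈ T')
    {Γ : List (Fm L n m)} {A : Fm L n m} (h : Prov T Γ A) :
    Prov T' (Γ.map (Fm.map s b)) (A.map s b) := by
  have wkN {n m : ℕ} (Γ : List (Fm L n m)) :
      (Γ.map Fm.wkN).map (Fm.map s b) = (Γ.map (Fm.map s b)).map Fm.wkN := by
    simp only [List.map_map, List.map_inj_left, Function.comp_apply, Fm.map_wkN, implies_true]
  have wkF {n m : ℕ} (Γ : List (Fm L n m)) :
      (Γ.map Fm.wkF).map (Fm.map s b) = (Γ.map (Fm.map s b)).map Fm.wkF := by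
    simp only [List.map_map, List.map_inj_left, Function.comp_apply, Fm.map_wkF, implies_true]
  induction h with
  | ax h => rw [Fm.map_ofSentence]; exact .ax (hT _ h)
  | hyp h => exact .hyp (List.mem_map_of_mem h)
  | botE _ ih => exact .botE ih
  | andI _ _ ih₁ ih₂ => exact .andI ih₁ ih₂
  | andE₁ _ ih => exact .andE₁ ih
  | andE₂ _ ih => exact .andE₂ ih
  | orI₁ _ ih => exact .orI₁ ih
  | orI₂ _ ih => exact .orI₂ ih
  | orE _ _ _ ih ih₁ ih₂ => exact .orE ih ih₁ ih₂
  | impI _ ih => exact .impI ih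
  | impE _ _ ih₁ ih₂ => exact .impE ih₁ ih₂
  | allNI _ ih => rw [wkN] at ih; exact .allNI ih
  | allNE _ t ih => rw [Fm.map_instN]; exact .allNE ih _
  | exNI t _ ih => rw [Fm.map_instN] at ih; exact .exNI _ ih
  | exNE _ _ ih ih₁ =>
    rw [List.map_cons, wkN, Fm.map_wkN] at ih₁
    exact .exNE ih ih₁
  | allFI _ ih => rw [wkF] at ih; exact .allFI ih
  | allFE _ a ih => rw [Fm.map_instF]; exact .allFE ih _
  | exFI a _ ih => rw [Fm.map_instF] at ih; exact .exFI _ ih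
  | exFE _ _ ih ih₁ =>
    rw [List.map_cons, wkF, Fm.map_wkF] at ih₁
    exact .exFE ih ih₁
  | eqI t => exact .eqI _
  | eqE A _ _ ih ih₁ =>
    rw [Fm.map_instN] at ih₁ ⊢
    exact .eqE _ ih ih₁

/-- Reading the arithmetical axioms in a larger language gives arithmetical axioms. -/
theorem PrAn1.map {A : Sentence L} (h : A ∈ PrAn1 L) : A.map s b ∈ PrAn1 L' := by
  have vec1 {n m : ℕ} (t : Tm L n m) :
      (fun i => (![t] i).map s) = ![t.map s] := by
    funext i; fin_cases i; rfl
  have cons {n m k : ℕ} (t : Tm L n m) (ts : Fin k → Tm L n m) :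
      (fun i => (Fin.cons (α := fun _ => Tm L n m) t ts i).map s) =
        Fin.cons (t.map s) (fun i => (ts i).map s) := by
    funext i
    exact Fin.cases rfl (fun i => rfl) i
  have mem {n m : ℕ} {A B : Fm L' n m} (h : B.closure ∈ PrAn1 L') (hAB : A = B) :
      A.closure ∈ PrAn1 L' := hAB ▸ h
  have zero {n m : ℕ} : (zeroT : Tm L n m).map s = zeroT := by
    simp only [zeroT, Tm.map]
    congr 1
    exact funext fun i => i.elim0
  have succ {n m : ℕ} (t : Tm L n m) : (succT t).map s = succT (t.map s) := by
    simp only [succT, Tm.map, vec1]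
  cases h <;> rw [Fm.map_closure]
  case succ_ne_zero =>
    refine mem (PrAn1.succ_ne_zero) ?_
    simp only [Fm.neg, Fm.map, succ, zero, Tm.map]
  case succ_inj =>
    refine mem (PrAn1.succ_inj) ?_
    simp only [Fm.map, succ, Tm.map]
  case induction A =>
    refine mem (PrAn1.induction (A.map s b)) ?_
    simp only [Fm.map, Fm.map_instN, zero, Fm.map_subst]
    congr 5
    funext i
    exact Fin.cases (succ _) (fun i => rfl) i
  case identity => exact PrAn1.identity
  case proj i => exact PrAn1.proj i
  case comp f g => exact PrAn1.comp f g
  case prec_zero f g =>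
    refine mem (PrAn1.prec_zero f g) ?_
    simp only [Fm.map, Tm.map, cons, zero]
  case prec_succ f g =>
    refine mem (PrAn1.prec_succ f g) ?_
    simp only [Fm.map, Tm.map, cons, succ]

theorem PrAn2.map {A : Sentence L} (h : A ∈ PrAn2 L) : A.map s b ∈ PrAn2 L' := by
  cases h with
  | mk t =>
    rw [Fm.map_closure]
    simp only [Fm.map, Tm.map, Tm.map_wkF]
    exact PrAn2.mk (t.map s)

end Translation

theorem FIM₀.isExtension (T : Theory LK) (hT : FIM₀plus ⊆ T) : IsExtension T FIM₀ := by
  refine fun A hA => Prov.map _ _ (fun B hB => hT ?_) hA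
  rcases hB with (hB | hB) | hB
  · exact .inl (.inl (.inl (PrAn1.map _ _ hB)))
  · exact .inl (.inr (PrAn2.map _ _ hB))
  · exact .inr ⟨B, hB, rfl⟩

/-! ### The standard interpretation of the primitive recursive functions -/

/-- The primitive recursive function with a given name. -/
def PR.eval : {n : ℕ} → PR n → (Fin n → ℕ) → ℕ
  | _, .zero, _ => 0
  | _, .succ, v => v 0 + 1
  | _, .proj i, v => v i
  | _, .comp f g, v => f.eval fun i => (g i).eval v
  | _, .prec f g, v =>
    Nat.rec (f.eval (Fin.tail v)) (fun y r => g.eval (Fin.cons y (Fin.cons r (Fin.tail v)))) (v 0)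

namespace PR

theorem eval_comp_one {n : ℕ} (f : PR 1) (g : PR n) (v : Fin n → ℕ) :
    (comp f ![g]).eval v = f.eval ![g.eval v] := by
  simp only [eval]
  congr 1
  funext i; fin_cases i; rfl

theorem eval_comp_two {n : ℕ} (f : PR 2) (g h : PR n) (v : Fin n → ℕ) :
    (comp f ![g, h]).eval v = f.eval ![g.eval v, h.eval v] := by
  simp only [eval]
  congr 1
  funext i; fin_cases i <;> rfl

theorem eval_comp_three {n : ℕ} (f : PR 3) (g h k : PR n) (v : Fin n → ℕ) :
    (comp f ![g, h, k]).eval v = f.eval ![g.eval v, h.eval v, k.eval v] := by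
  simp only [eval]
  congr 1
  funext i; fin_cases i <;> rfl

theorem eval_prec_zero {n : ℕ} (f : PR n) (g : PR (n + 2)) (v : Fin n → ℕ) :
    (prec f g).eval (Fin.cons 0 v) = f.eval v := by
  simp [eval]

theorem eval_prec_succ {n : ℕ} (f : PR n) (g : PR (n + 2)) (y : ℕ) (v : Fin n → ℕ) :
    (prec f g).eval (Fin.cons (y + 1) v) =
      g.eval (Fin.cons y (Fin.cons ((prec f g).eval (Fin.cons y v)) v)) := by
  simp [eval]

theorem eval_null {n : ℕ} (v : Fin n → ℕ) : (null : PR n).eval v = 0 := by simp [null, eval]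

theorem eval_one {n : ℕ} (v : Fin n → ℕ) : (one : PR n).eval v = 1 := by
  simp [one, eval, eval_null]

theorem eval_proj {n : ℕ} (i : Fin n) (v : Fin n → ℕ) : (proj i).eval v = v i := rfl

theorem eval_succ (a : ℕ) : succ.eval ![a] = a + 1 := rfl

theorem eval_add (a b : ℕ) : add.eval ![a, b] = a + b := by
  induction a with
  | zero => exact (eval_prec_zero _ _ ![b]).trans (Nat.zero_add b).symm
  | succ a ih =>
    refine (eval_prec_succ _ _ a ![b]).trans ?_
    rw [eval_comp_one, eval_succ]
    refine (congrArg (· + 1) ih).trans ?_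
    omega

theorem eval_pred (a : ℕ) : pred.eval ![a] = a - 1 := by
  cases a with
  | zero => exact eval_prec_zero _ _ ![]
  | succ a => exact eval_prec_succ _ _ a ![]

theorem eval_sub (a b : ℕ) : sub.eval ![a, b] = a - b := by
  rw [sub, eval_comp_two]
  simp only [eval_proj]
  change (prec (proj 0) (comp pred ![proj 1])).eval ![b, a] = _
  induction b with
  | zero => exact eval_prec_zero _ _ ![a]
  | succ b ih =>
    refine (eval_prec_succ _ _ b ![a]).trans ?_
    rw [eval_comp_one]
    change pred.eval ![(prec (proj 0) (comp pred ![proj 1])).eval ![b, a]] = _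
    rw [ih, eval_pred]
    omega

/-- The sum of the numbers up to `n`. -/
def triangle : ℕ → ℕ
  | 0 => 0
  | n + 1 => n + triangle n + 1

theorem triangle_mono {a b : ℕ} (h : a ≤ b) : triangle a ≤ triangle b :=
  monotone_nat_of_le_succ (fun n => by rw [triangle]; omega) h

theorem eval_tri (a : ℕ) : tri.eval ![a] = triangle a := by
  induction a with
  | zero => exact eval_prec_zero _ _ ![]
  | succ a ih =>
    refine (eval_prec_succ _ _ a ![]).trans ?_
    rw [eval_comp_one, eval_succ, eval_comp_two, eval_add]
    exact congrArg (fun r => a + r + 1) ih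

theorem eval_root_succ (a : ℕ) : root.eval ![a + 1] =
    root.eval ![a] + (1 - (triangle (root.eval ![a] + 1) - (a + 1))) := by
  refine (eval_prec_succ _ _ a ![]).trans ?_
  rw [eval_comp_two, eval_add, eval_comp_two, eval_sub, eval_one, eval_comp_two, eval_sub,
    eval_comp_one, eval_comp_one, eval_comp_one, eval_tri, eval_succ, eval_succ]
  rfl

theorem triangle_root (a : ℕ) :
    triangle (root.eval ![a]) ≤ a ∧ a < triangle (root.eval ![a] + 1) := by
  induction a with
  | zero =>
    have : root.eval ![0] = 0 := eval_prec_zero _ _ ![]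
    simp [this, triangle]
  | succ a ih =>
    rw [eval_root_succ]
    generalize root.eval ![a] = r at ih
    by_cases h : triangle (r + 1) ≤ a + 1
    · have : 1 - (triangle (r + 1) - (a + 1)) = 1 := by omega
      rw [this]
      refine ⟨h, ?_⟩
      rw [triangle]
      omega
    · have : 1 - (triangle (r + 1) - (a + 1)) = 0 := by omega
      rw [this]
      exact ⟨by rw [add_zero]; omega, by rw [add_zero]; omega⟩

theorem root_eq {a r : ℕ} (h : triangle r ≤ a) (h' : a < triangle (r + 1)) :
    root.eval ![a] = r := by
  obtain ⟨h₁, h₂⟩ := triangle_root a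
  rcases lt_trichotomy (root.eval ![a]) r with hr | hr | hr
  · have := triangle_mono hr
    simp only [Nat.succ_eq_add_one] at this
    omega
  · exact hr
  · have := triangle_mono hr
    simp only [Nat.succ_eq_add_one] at this
    omega

theorem eval_pair (a b : ℕ) : pair.eval ![a, b] = triangle (a + b) + b := by
  rw [pair, eval_comp_two, eval_add, eval_comp_one, eval_comp_two, eval_add, eval_tri]
  rfl

theorem eval_snd (a : ℕ) : snd.eval ![a] = a - triangle (root.eval ![a]) := by
  rw [snd, eval_comp_two, eval_sub, eval_comp_one, eval_tri]
  rfl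

theorem eval_fst (a : ℕ) : fst.eval ![a] = root.eval ![a] - snd.eval ![a] := by
  rw [fst, eval_comp_two, eval_sub]

theorem root_pair (a b : ℕ) : root.eval ![pair.eval ![a, b]] = a + b := by
  rw [eval_pair]
  refine root_eq (by omega) ?_
  rw [triangle]
  omega

theorem snd_pair (a b : ℕ) : snd.eval ![pair.eval ![a, b]] = b := by
  rw [eval_snd, root_pair, eval_pair]
  omega

theorem fst_pair (a b : ℕ) : fst.eval ![pair.eval ![a, b]] = a := by
  rw [eval_fst, root_pair, snd_pair]
  omega

theorem pair_fst_snd (a : ℕ) : pair.eval ![fst.eval ![a], snd.eval ![a]] = a := by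
  obtain ⟨h₁, h₂⟩ := triangle_root a
  have h₃ := eval_snd a
  have h₄ := eval_fst a
  rw [triangle] at h₂
  have : fst.eval ![a] + snd.eval ![a] = root.eval ![a] := by omega
  rw [eval_pair, this]
  omega

theorem snd_le (a : ℕ) : snd.eval ![a] ≤ a := by
  rw [eval_snd]
  omega

theorem eval_cons (a b : ℕ) : cons.eval ![a, b] = pair.eval ![a, b] + 1 := by
  rw [cons, eval_comp_one, eval_succ]

end PR

/-- The code of a finite sequence. -/
def enc : List ℕ → ℕ
  | [] => 0
  | a :: l => PR.cons.eval ![a, enc l]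

/-- The finite sequence with a given code. -/
def dec : ℕ → List ℕ
  | 0 => []
  | x + 1 => PR.fst.eval ![x] :: dec (PR.snd.eval ![x])
decreasing_by exact Nat.lt_succ_of_le (PR.snd_le x)

theorem enc_dec (x : ℕ) : enc (dec x) = x := by
  induction x using Nat.strong_induction_on with
  | _ x ih =>
    cases x with
    | zero => rw [dec, enc]
    | succ x =>
      rw [dec, enc, ih _ (Nat.lt_succ_of_le (PR.snd_le x)), PR.eval_cons, PR.pair_fst_snd]

theorem dec_zero : dec 0 = [] := by rw [dec]

theorem dec_cons (a x : ℕ) : dec (PR.cons.eval ![a, x]) = a :: dec x := by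
  rw [PR.eval_cons, dec, PR.fst_pair, PR.snd_pair]

theorem dec_enc (l : List ℕ) : dec (enc l) = l := by
  induction l with
  | nil => exact dec_zero
  | cons a l ih => rw [enc, dec_cons, ih]

namespace PR

theorem eval_tail (x : ℕ) : tail.eval ![x] = enc (dec x).tail := by
  rw [tail, eval_comp_one]
  rw [eval_pred]
  cases x with
  | zero =>
    rw [dec_zero, eval_snd]
    simp [enc]
  | succ x => rw [dec, List.tail_cons, enc_dec]; rfl

theorem eval_head (x : ℕ) : head.eval ![x] = (dec x).getD 0 0 := by
  rw [head, eval_comp_one]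
  rw [eval_pred]
  cases x with
  | zero =>
    rw [dec_zero, eval_fst]
    have : root.eval ![0] = 0 := eval_prec_zero _ _ ![]
    simp [this]
  | succ x => rw [dec]; rfl

theorem eval_drop (i x : ℕ) : drop.eval ![i, x] = enc ((dec x).drop i) := by
  induction i with
  | zero => exact (eval_prec_zero _ _ ![x]).trans (enc_dec x).symm
  | succ i ih =>
    refine (eval_prec_succ _ _ i ![x]).trans ?_
    rw [eval_comp_one]
    change tail.eval ![drop.eval ![i, x]] = _
    rw [ih, eval_tail, dec_enc, List.tail_drop]

theorem eval_nth (x i : ℕ) : nth.eval ![x, i] = (dec x).getD i 0 := by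
  rw [nth, eval_comp_one, eval_comp_two]
  change head.eval ![drop.eval ![i, x]] = _
  rw [eval_drop, eval_head, dec_enc]
  simp [List.getD_eq_getElem?_getD]

theorem length_le_enc (l : List ℕ) : l.length ≤ enc l := by
  induction l with
  | nil => exact le_rfl
  | cons a l ih =>
    rw [enc, eval_cons, eval_pair, List.length_cons]
    omega

theorem eval_len (x : ℕ) : len.eval ![x] = (dec x).length := by
  have key : ∀ y, (prec (null : PR 1) (comp add ![proj 1,
      comp sub ![one, comp sub ![one, comp drop ![proj 0, proj 2]]]])).eval ![y, x] =
        min y (dec x).length := by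
    intro y
    induction y with
    | zero => exact (eval_prec_zero _ _ ![x]).trans ((eval_null _).trans (Nat.zero_min _).symm)
    | succ y ih =>
      refine (eval_prec_succ _ _ y ![x]).trans ?_
      rw [eval_comp_two, eval_add, eval_comp_two, eval_sub, eval_comp_two, eval_sub, eval_one,
        eval_comp_two]
      change (prec (null : PR 1) (comp add ![proj 1,
        comp sub ![one, comp sub ![one, comp drop ![proj 0, proj 2]]]])).eval ![y, x] +
          (1 - (1 - drop.eval ![y, x])) = _
      rw [ih, eval_drop]
      by_cases h : y < (dec x).length
      · have h₁ := length_le_enc ((dec x).drop y)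
        rw [List.length_drop] at h₁
        omega
      · rw [List.drop_eq_nil_of_le (by omega)]
        simp only [enc]
        omega
  rw [len, eval_comp_two]
  refine (key x).trans (min_eq_right ?_)
  conv_rhs => rw [← enc_dec x]
  exact length_le_enc _

theorem eval_cat (x y : ℕ) : cat.eval ![x, y] = enc (dec x ++ dec y) := by
  have key : ∀ j ≤ (dec x).length, (prec (proj 1) (comp cons
      ![comp nth ![proj 2, comp sub ![comp len ![proj 2], comp succ ![proj 0]]], proj 1])).eval
        ![j, x, y] = enc ((dec x).drop ((dec x).length - j) ++ dec y) := by
    intro j hj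
    induction j with
    | zero =>
      refine (eval_prec_zero _ _ ![x, y]).trans ?_
      rw [Nat.sub_zero, List.drop_length, List.nil_append, enc_dec]
      rfl
    | succ j ih =>
      refine (eval_prec_succ _ _ j ![x, y]).trans ?_
      rw [eval_comp_two, eval_comp_two, eval_nth, eval_comp_two, eval_sub, eval_comp_one,
        eval_comp_one, eval_succ]
      change cons.eval ![(dec x).getD (len.eval ![x] - (j + 1)) 0, (prec (proj 1) (comp cons
        ![comp nth ![proj 2, comp sub ![comp len ![proj 2], comp succ ![proj 0]]], proj 1])).eval
          ![j, x, y]] = _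
      rw [ih (by omega), eval_len]
      have h : (dec x).length - (j + 1) < (dec x).length := by omega
      rw [List.drop_eq_getElem_cons h, List.cons_append, enc, List.getD_eq_getElem _ _ h]
      congr 6
      omega
  rw [cat, eval_comp_three, eval_comp_one]
  refine Eq.trans ?_ ((key (dec x).length le_rfl).trans (by rw [Nat.sub_self, List.drop_zero]))
  rw [← eval_len]
  rfl

end PR

/-! ### Continuous functions on Baire space -/

/-- Baire space. -/
abbrev Baire : Type := ℕ → ℕ

/-- Functions that are continuous on the pieces of a clopen partition are continuous. -/
theorem continuous_piece {Y : Type*} [TopologicalSpace Y] {k : Baire → ℕ} (hk : Continuous k)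
    {F : ℕ → Baire → Y} (hF : ∀ n, Continuous (F n)) : Continuous fun x => F (k x) x :=
  (continuous_prod_of_discrete_left.2 hF : Continuous fun p : ℕ × Baire => F p.1 p.2).comp
    (hk.prodMk continuous_id)

theorem Continuous.eval_pr {k : ℕ} (f : PR k) {v : Baire → Fin k → ℕ}
    (hv : ∀ i, Continuous fun x => v x i) : Continuous fun x => f.eval (v x) :=
  continuous_of_discreteTopology.comp (continuous_pi hv)

theorem continuous_eval {k : Baire → ℕ} (hk : Continuous k) {α : Baire → Baire}
    (hα : Continuous α) : Continuous fun x => α x (k x) :=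
  continuous_piece hk fun n => (continuous_apply n).comp hα

theorem continuous_finCons {n : ℕ} {Y : Type} [TopologicalSpace Y] {k : Baire → Y}
    (hk : Continuous k) {ρ : Baire → Fin n → Y} (hρ : Continuous ρ) :
    Continuous fun x => (Fin.cons (k x) (ρ x) : Fin (n + 1) → Y) := by
  refine continuous_pi fun i => ?_
  refine Fin.cases hk (fun i => ?_) i
  exact (continuous_apply i).comp hρ

/-- A clopen choice of witnesses. -/
theorem exists_continuous_choice {P : Baire → ℕ → Prop} (hP : ∀ n, IsClopen {x | P x n})
    (h : ∀ x, ∃ n, P x n) : ∃ k : Baire → ℕ, Continuous k ∧ ∀ x, P x (k x) := by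
  classical
  refine ⟨fun x => Nat.find (h x), ?_, fun x => Nat.find_spec (h x)⟩
  refine continuous_discrete_rng.2 fun n => ?_
  have : (fun x => Nat.find (h x)) ⁻¹' {n} =
      {x | P x n} ∩ ⋂ i ∈ Finset.range n, {x | P x i}ᶜ := by
    ext x
    simp [Nat.find_eq_iff]
  rw [this]
  exact (hP n).2.inter (isOpen_biInter_finset fun i _ => (hP i).1.isOpen_compl)

theorem isClopen_eq {k l : Baire → ℕ} (hk : Continuous k) (hl : Continuous l) :
    IsClopen {x | k x = l x} :=
  (isClopen_discrete {p : ℕ × ℕ | p.1 = p.2}).preimage (hk.prodMk hl)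

/-- A retraction onto a piece of a clopen partition. -/
theorem exists_retraction {g : Baire → ℕ} (hg : Continuous g) {i : ℕ} (h : ∃ x, g x = i) :
    ∃ r : Baire → Baire, Continuous r ∧ (∀ x, g (r x) = i) ∧ ∀ x, g x = i → r x = x := by
  obtain ⟨x₀, h₀⟩ := h
  refine ⟨fun x => if g x = i then x else x₀,
    continuous_piece (F := fun n x => if n = i then x else x₀) hg fun n => ?_, fun x => ?_,
    fun x hx => if_pos hx⟩
  · split_ifs <;> fun_prop
  · dsimp only
    split_ifs with hx
    exacts [hx, h₀]

theorem exists_retractions {g : Baire → ℕ} (hg : Continuous g) :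
    ∃ r : ℕ → Baire → Baire, (∀ i, Continuous (r i)) ∧ ∀ i, (∃ x, g x = i) →
      (∀ x, g (r i x) = i) ∧ ∀ x, g x = i → r i x = x := by
  have h : ∀ i, ∃ r : Baire → Baire, Continuous r ∧ ((∃ x, g x = i) →
      (∀ x, g (r x) = i) ∧ ∀ x, g x = i → r x = x) := by
    intro i
    by_cases hi : ∃ x, g x = i
    · obtain ⟨r, hr, h⟩ := exists_retraction hg hi
      exact ⟨r, hr, fun _ => h⟩
    · exact ⟨id, continuous_id, fun h => absurd h hi⟩
  choose r hr hr' using h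
  exact ⟨r, hr, hr'⟩

/-- The sequence of the values of `α` below `n`. -/
def initial (α : Baire) (n : ℕ) : List ℕ := (List.range n).map α

theorem length_initial (α : Baire) (n : ℕ) : (initial α n).length = n := by simp [initial]

theorem initial_succ (α : Baire) (n : ℕ) : initial α (n + 1) = initial α n ++ [α n] := by
  simp [initial, List.range_succ]

theorem take_initial {α : Baire} {i n : ℕ} (h : i ≤ n) : (initial α n).take i = initial α i := by
  rw [initial, ← List.map_take, List.take_range, min_eq_left h, initial]

theorem initial_congr {α β : Baire} {n : ℕ} :
    initial α n = initial β n ↔ ∀ i < n, α i = β i := by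
  simp [initial]

theorem eq_initial_iff {l : List ℕ} {α : Baire} {n : ℕ} :
    l = initial α n ↔ l.length = n ∧ ∀ i < n, l.getD i 0 = α i := by
  constructor
  · rintro rfl
    refine ⟨length_initial _ _, fun i hi => ?_⟩
    simp [initial, hi]
  · rintro ⟨rfl, h⟩
    refine List.ext_getElem (length_initial _ _).symm fun i h₁ h₂ => ?_
    rw [← List.getD_eq_getElem l 0 h₁, h i h₁]
    simp [initial]

theorem continuous_enc_initial {k : Baire → ℕ} (hk : Continuous k) {α : Baire → Baire}
    (hα : Continuous α) : Continuous fun x => enc (initial (α x) (k x)) := by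
  refine continuous_piece (F := fun n x => enc (initial (α x) n)) hk fun n => ?_
  unfold initial
  induction List.range n with
  | nil => exact continuous_const
  | cons a l ih =>
    simp only [List.map_cons, enc]
    refine Continuous.eval_pr _ fun i => ?_
    fin_cases i
    · exact (continuous_apply a).comp hα
    · exact ih

/-- The standard splitting of Baire space as its own square. -/
theorem exists_pairing : ∃ (p : Baire → Baire → Baire) (p₁ p₂ : Baire → Baire),
    Continuous (fun q : Baire × Baire => p q.1 q.2) ∧ Continuous p₁ ∧ Continuous p₂ ∧
      (∀ x y, p₁ (p x y) = x) ∧ ∀ x y, p₂ (p x y) = y := by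
  refine ⟨fun x y n => if n % 2 = 0 then x (n / 2) else y (n / 2), fun x n => x (2 * n),
    fun x n => x (2 * n + 1), ?_, by fun_prop, by fun_prop, fun x y => ?_, fun x y => ?_⟩
  · refine continuous_pi fun n => ?_
    dsimp only
    split_ifs <;> fun_prop
  · funext n
    simp
  · funext n
    have h : (2 * n + 1) / 2 = n := by omega
    simp [h]

/-- The local modulus of a continuous functional of two arguments. -/
theorem exists_modulus {k : Baire × Baire → ℕ} (hk : Continuous k) (x α : Baire) :
    ∃ n, ∀ x' α', initial x' n = initial x n → initial α' n = initial α n →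
      k (x', α') = k (x, α) := by
  have h : k ⁻¹' {k (x, α)} ∈ nhds (x, α) := hk.continuousAt (isOpen_discrete _ |>.mem_nhds rfl)
  rw [nhds_prod_eq, Filter.mem_prod_iff] at h
  obtain ⟨U, hU, V, hV, h⟩ := h
  have key : ∀ (x : Baire), ∀ U ∈ nhds x, ∃ n, ∀ x', initial x' n = initial x n → x' ∈ U := by
    intro x U hU
    obtain ⟨_, ⟨⟨y, n, rfl⟩, hx, hs⟩⟩ :=
      (PiNat.isTopologicalBasis_cylinders (fun _ => ℕ)).mem_nhds_iff.1 hU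
    refine ⟨n, fun x' hx' => hs ?_⟩
    rw [initial_congr] at hx'
    intro i hi
    rw [hx' i hi]
    exact hx i hi
  obtain ⟨n₁, h₁⟩ := key x U hU
  obtain ⟨n₂, h₂⟩ := key α V hV
  refine ⟨max n₁ n₂, fun x' α' hx hα => h (Set.mk_mem_prod (h₁ _ ?_) (h₂ _ ?_))⟩
  · rw [initial_congr] at hx ⊢
    exact fun i hi => hx i (lt_max_of_lt_left hi)
  · rw [initial_congr] at hα ⊢
    exact fun i hi => hα i (lt_max_of_lt_right hi)

/-! ### Forcing over the monoid of continuous functions -/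

/-- The value of a term of analysis. -/
def Tm.val {n m : ℕ} (ρ : Fin n → ℕ) (σ : Fin m → Baire) : Tm L₀ n m → ℕ
  | .var i => ρ i
  | .app a t => σ a (t.val ρ σ)
  | .pr f ts => f.eval fun i => (ts i).val ρ σ
  | .sym s _ _ => Empty.elim s

/-- The sheaf semantics of the language of analysis over the monoid of continuous functions from
Baire space to itself. A number variable stands for a continuous function from Baire space to
`ℕ`, a choice sequence variable for a continuous function from Baire space to itself; a
disjunction splits Baire space into two clopen parts, and to be forced on a part means to be
forced after composition with every continuous function into it. -/
def Forces : {n m : ℕ} → Fm L₀ n m → (Baire → Fin n → ℕ) → (Baire → Fin m → Baire) → Prop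
  | _, _, .eq t s, ρ, σ => ∀ x, t.val (ρ x) (σ x) = s.val (ρ x) (σ x)
  | _, _, .bot, _, _ => False
  | _, _, .and A B, ρ, σ => Forces A ρ σ ∧ Forces B ρ σ
  | _, _, .or A B, ρ, σ => ∃ k : Baire → ℕ, Continuous k ∧
      (∀ f : Baire → Baire, Continuous f → (∀ x, k (f x) = 0) →
        Forces A (fun x => ρ (f x)) fun x => σ (f x)) ∧
      (∀ f : Baire → Baire, Continuous f → (∀ x, k (f x) ≠ 0) →
        Forces B (fun x => ρ (f x)) fun x => σ (f x))
  | _, _, .imp A B, ρ, σ => ∀ f : Baire → Baire, Continuous f →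
      Forces A (fun x => ρ (f x)) (fun x => σ (f x)) →
        Forces B (fun x => ρ (f x)) fun x => σ (f x)
  | _, _, .allN A, ρ, σ => ∀ (f : Baire → Baire) (k : Baire → ℕ), Continuous f → Continuous k →
      Forces A (fun x => Fin.cons (k x) (ρ (f x))) fun x => σ (f x)
  | _, _, .exN A, ρ, σ => ∃ k : Baire → ℕ, Continuous k ∧
      Forces A (fun x => Fin.cons (k x) (ρ x)) σ
  | _, _, .allF A, ρ, σ => ∀ (f α : Baire → Baire), Continuous f → Continuous α →
      Forces A (fun x => ρ (f x)) fun x => Fin.cons (α x) (σ (f x))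
  | _, _, .exF A, ρ, σ => ∃ α : Baire → Baire, Continuous α ∧
      Forces A ρ fun x => Fin.cons (α x) (σ x)
  | _, _, .box h _ _, _, _ => False.elim h

section Forcing

variable {n m n' m' : ℕ}

theorem Tm.val_subst (τ : Fin n → Tm L₀ n' m') (π : Fin m → Fin m') (ρ : Fin n' → ℕ)
    (σ : Fin m' → Baire) (t : Tm L₀ n m) :
    (t.subst τ π).val ρ σ = t.val (fun i => (τ i).val ρ σ) fun j => σ (π j) := by
  induction t with
  | var i => rfl
  | app a t ih => simp only [Tm.subst, Tm.val, ih]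
  | pr f ts ih => simp only [Tm.subst, Tm.val, ih]
  | sym s ts as ih => exact Empty.elim s

theorem Tm.val_wkN (t : Tm L₀ n m) (k : ℕ) (ρ : Fin n → ℕ) (σ : Fin m → Baire) :
    t.wkN.val (Fin.cons k ρ) σ = t.val ρ σ := Tm.val_subst ..

theorem Tm.val_wkF (t : Tm L₀ n m) (α : Baire) (ρ : Fin n → ℕ) (σ : Fin m → Baire) :
    t.wkF.val ρ (Fin.cons α σ) = t.val ρ σ := Tm.val_subst ..

theorem val_upN (τ : Fin n → Tm L₀ n' m') (k : Baire → ℕ) (ρ : Baire → Fin n' → ℕ)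
    (σ : Baire → Fin m' → Baire) :
    (fun x i => (upN τ i).val (Fin.cons (k x) (ρ x)) (σ x)) =
      fun x => Fin.cons (k x) fun i => (τ i).val (ρ x) (σ x) := by
  funext x i
  refine Fin.cases rfl (fun i => ?_) i
  simp only [upN, Fin.cases_succ, Fin.cons_succ, Tm.val_wkN]

theorem cons_upF (π : Fin m → Fin m') (α : Baire → Baire) (σ : Baire → Fin m' → Baire) :
    (fun x j => (Fin.cons (α x) (σ x) : Fin (m' + 1) → Baire) (upF π j)) =
      fun x => Fin.cons (α x) fun j => σ x (π j) := by
  funext x j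
  exact Fin.cases rfl (fun j => rfl) j

theorem forces_subst (A : Fm L₀ n m) : ∀ {n' m' : ℕ} (τ : Fin n → Tm L₀ n' m')
    (π : Fin m → Fin m') (ρ : Baire → Fin n' → ℕ) (σ : Baire → Fin m' → Baire),
    Forces (A.subst τ π) ρ σ ↔
      Forces A (fun x i => (τ i).val (ρ x) (σ x)) fun x j => σ x (π j) := by
  induction A with
  | box h => exact h.elim
  | _ => intro n' m' τ π ρ σ; simp only [Fm.subst, Forces, Tm.val_subst, val_upN, cons_upF,
      Tm.val_wkF, *]

theorem forces_wkN (A : Fm L₀ n m) (k : Baire → ℕ) (ρ : Baire → Fin n → ℕ)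
    (σ : Baire → Fin m → Baire) :
    Forces A.wkN (fun x => Fin.cons (k x) (ρ x)) σ ↔ Forces A ρ σ := forces_subst ..

theorem forces_wkF (A : Fm L₀ n m) (α : Baire → Baire) (ρ : Baire → Fin n → ℕ)
    (σ : Baire → Fin m → Baire) :
    Forces A.wkF ρ (fun x => Fin.cons (α x) (σ x)) ↔ Forces A ρ σ := forces_subst ..

theorem forces_instN (A : Fm L₀ (n + 1) m) (t : Tm L₀ n m) (ρ : Baire → Fin n → ℕ)
    (σ : Baire → Fin m → Baire) :
    Forces (A.instN t) ρ σ ↔ Forces A (fun x => Fin.cons (t.val (ρ x) (σ x)) (ρ x)) σ := by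
  rw [Fm.instN, forces_subst]
  have : (fun x i => (Fin.cases t .var i : Tm L₀ n m).val (ρ x) (σ x)) =
      fun x => (Fin.cons (t.val (ρ x) (σ x)) (ρ x) : Fin (n + 1) → ℕ) := by
    funext x i
    exact Fin.cases rfl (fun i => rfl) i
  rw [this]
  rfl

theorem forces_instF (A : Fm L₀ n (m + 1)) (a : Fin m) (ρ : Baire → Fin n → ℕ)
    (σ : Baire → Fin m → Baire) :
    Forces (A.instF a) ρ σ ↔ Forces A ρ fun x => Fin.cons (σ x a) (σ x) := by
  rw [Fm.instF, forces_subst]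
  have : (fun x j => σ x (Fin.cases a id j)) =
      fun x => (Fin.cons (σ x a) (σ x) : Fin (m + 1) → Baire) := by
    funext x j
    exact Fin.cases rfl (fun j => rfl) j
  rw [this]
  rfl

theorem Forces.mono {A : Fm L₀ n m} {ρ : Baire → Fin n → ℕ} {σ : Baire → Fin m → Baire}
    (h : Forces A ρ σ) {f : Baire → Baire} (hf : Continuous f) :
    Forces A (fun x => ρ (f x)) fun x => σ (f x) := by
  induction A generalizing f with
  | eq t s => exact fun x => h (f x)
  | bot => exact h
  | and A B ihA ihB => exact ⟨ihA h.1 hf, ihB h.2 hf⟩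
  | or A B ihA ihB =>
    obtain ⟨k, hk, hA, hB⟩ := h
    exact ⟨fun x => k (f x), hk.comp hf, fun g hg hkg => hA _ (hf.comp hg) hkg,
      fun g hg hkg => hB _ (hf.comp hg) hkg⟩
  | imp A B ihA ihB => exact fun g hg hA => h _ (hf.comp hg) hA
  | allN A ih => exact fun g k hg hk => h _ k (hf.comp hg) hk
  | exN A ih =>
    obtain ⟨k, hk, hA⟩ := h
    exact ⟨fun x => k (f x), hk.comp hf, ih hA hf⟩
  | allF A ih => exact fun g α hg hα => h _ α (hf.comp hg) hα
  | exF A ih =>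
    obtain ⟨α, hα, hA⟩ := h
    exact ⟨fun x => α (f x), hα.comp hf, ih hA hf⟩
  | box hb => exact False.elim hb

/-- Being forced is local: it may be checked on the pieces of a clopen partition. -/
theorem Forces.glue {A : Fm L₀ n m} {ρ : Baire → Fin n → ℕ} {σ : Baire → Fin m → Baire}
    {g : Baire → ℕ} (hg : Continuous g)
    (h : ∀ (i : ℕ) (f : Baire → Baire), Continuous f → (∀ x, g (f x) = i) →
      Forces A (fun x => ρ (f x)) fun x => σ (f x)) : Forces A ρ σ := by
  induction A generalizing g with
  | eq t s => exact fun x => h (g x) (fun _ => x) continuous_const (fun _ => rfl) x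
  | bot => exact h (g 0) (fun _ => 0) continuous_const fun _ => rfl
  | and A B ihA ihB =>
    exact ⟨ihA hg fun i f hf hi => (h i f hf hi).1, ihB hg fun i f hf hi => (h i f hf hi).2⟩
  | or A B ihA ihB =>
    obtain ⟨r, hr, hr'⟩ := exists_retractions hg
    have h' : ∀ i, ∃ k : Baire → ℕ, Continuous k ∧ ((∃ x, g x = i) →
        (∀ f : Baire → Baire, Continuous f → (∀ x, k (f x) = 0) →
          Forces A (fun x => ρ (r i (f x))) fun x => σ (r i (f x))) ∧
        (∀ f : Baire → Baire, Continuous f → (∀ x, k (f x) ≠ 0) →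
          Forces B (fun x => ρ (r i (f x))) fun x => σ (r i (f x)))) := by
      intro i
      by_cases hi : ∃ x, g x = i
      · obtain ⟨k, hk, h'⟩ := h i (r i) (hr i) (hr' i hi).1
        exact ⟨k, hk, fun _ => h'⟩
      · exact ⟨fun _ => 0, continuous_const, fun h => absurd h hi⟩
    choose k hk hk' using h'
    refine ⟨fun x => k (g x) x, continuous_piece hg hk, fun f hf hkf => ?_, fun f hf hkf => ?_⟩
    · refine ihA (hg.comp hf) fun i f' hf' hi => ?_
      have hi' : ∃ x, g x = i := ⟨_, hi 0⟩
      have := (hk' i hi').1 _ (hf.comp hf') fun x => by rw [← hkf (f' x)]; exact hi x ▸ rfl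
      simpa only [(hr' i hi').2 _ (hi _), Function.comp] using this
    · refine ihB (hg.comp hf) fun i f' hf' hi => ?_
      have hi' : ∃ x, g x = i := ⟨_, hi 0⟩
      have := (hk' i hi').2 _ (hf.comp hf') fun x => by
        have := hkf (f' x)
        dsimp only at this
        rwa [show g (f (f' x)) = i from hi x] at this
      simpa only [(hr' i hi').2 _ (hi _), Function.comp] using this
  | imp A B ihA ihB =>
    intro f hf hA
    exact ihB (hg.comp hf) fun i f' hf' hi =>
      h i _ (hf.comp hf') hi id continuous_id (hA.mono hf')
  | allN A ih =>
    intro f k hf hk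
    exact ih (hg.comp hf) fun i f' hf' hi =>
      h i _ (hf.comp hf') hi id _ continuous_id (hk.comp hf')
  | exN A ih =>
    obtain ⟨r, hr, hr'⟩ := exists_retractions hg
    have h' : ∀ i, ∃ k : Baire → ℕ, Continuous k ∧ ((∃ x, g x = i) →
        Forces A (fun x => Fin.cons (k x) (ρ (r i x))) fun x => σ (r i x)) := by
      intro i
      by_cases hi : ∃ x, g x = i
      · obtain ⟨k, hk, h'⟩ := h i (r i) (hr i) (hr' i hi).1
        exact ⟨k, hk, fun _ => h'⟩
      · exact ⟨fun _ => 0, continuous_const, fun h => absurd h hi⟩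
    choose k hk hk' using h'
    refine ⟨fun x => k (g x) x, continuous_piece hg hk, ih hg fun i f hf hi => ?_⟩
    have hi' : ∃ x, g x = i := ⟨_, hi 0⟩
    simpa only [(hr' i hi').2 _ (hi _), hi] using (hk' i hi').mono hf
  | allF A ih =>
    intro f α hf hα
    exact ih (hg.comp hf) fun i f' hf' hi =>
      h i _ (hf.comp hf') hi id _ continuous_id (hα.comp hf')
  | exF A ih =>
    obtain ⟨r, hr, hr'⟩ := exists_retractions hg
    have h' : ∀ i, ∃ α : Baire → Baire, Continuous α ∧ ((∃ x, g x = i) →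
        Forces A (fun x => ρ (r i x)) fun x => Fin.cons (α x) (σ (r i x))) := by
      intro i
      by_cases hi : ∃ x, g x = i
      · obtain ⟨α, hα, h'⟩ := h i (r i) (hr i) (hr' i hi).1
        exact ⟨α, hα, fun _ => h'⟩
      · exact ⟨id, continuous_id, fun h => absurd h hi⟩
    choose α hα hα' using h'
    refine ⟨fun x => α (g x) x, continuous_piece hg hα, ih hg fun i f hf hi => ?_⟩
    have hi' : ∃ x, g x = i := ⟨_, hi 0⟩
    simpa only [(hr' i hi').2 _ (hi _), hi] using (hα' i hi').mono hf
  | box hb => exact False.elim hb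

theorem Tm.continuous_val {ρ : Baire → Fin n → ℕ} (hρ : Continuous ρ)
    {σ : Baire → Fin m → Baire} (hσ : Continuous σ) (t : Tm L₀ n m) :
    Continuous fun x => t.val (ρ x) (σ x) := by
  induction t with
  | var i => exact (continuous_apply i).comp hρ
  | app a t ih => exact continuous_eval ih ((continuous_apply a).comp hσ)
  | pr f ts ih => exact Continuous.eval_pr f ih
  | sym s ts as ih => exact Empty.elim s

/-- Intuitionistic logic is sound for forcing. -/
theorem Prov.forces {T : Theory L₀} (hT : ∀ A ∈ T, ∀ ρ σ, Forces A ρ σ) {Γ : List (Fm L₀ n m)}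
    {A : Fm L₀ n m} (h : Prov T Γ A) : ∀ {ρ : Baire → Fin n → ℕ} {σ : Baire → Fin m → Baire},
    Continuous ρ → Continuous σ → (∀ B ∈ Γ, Forces B ρ σ) → Forces A ρ σ := by
  -- the assumptions of a premise with one more assumption or one more variable
  have cons {n m : ℕ} {Γ : List (Fm L₀ n m)} {ρ : Baire → Fin n → ℕ}
      {σ : Baire → Fin m → Baire} {A : Fm L₀ n m} (hA : Forces A ρ σ)
      (hΓ : ∀ B ∈ Γ, Forces B ρ σ) : ∀ B ∈ A :: Γ, Forces B ρ σ := by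
    intro B hB
    rcases List.mem_cons.1 hB with rfl | hB
    exacts [hA, hΓ B hB]
  have wkN {n m : ℕ} {Γ : List (Fm L₀ n m)} {ρ : Baire → Fin n → ℕ}
      {σ : Baire → Fin m → Baire} (k : Baire → ℕ) (hΓ : ∀ B ∈ Γ, Forces B ρ σ) :
      ∀ B ∈ Γ.map Fm.wkN, Forces B (fun x => Fin.cons (k x) (ρ x)) σ := by
    intro B hB
    obtain ⟨C, hC, rfl⟩ := List.mem_map.1 hB
    exact (forces_wkN ..).2 (hΓ C hC)
  have wkF {n m : ℕ} {Γ : List (Fm L₀ n m)} {ρ : Baire → Fin n → ℕ}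
      {σ : Baire → Fin m → Baire} (α : Baire → Baire) (hΓ : ∀ B ∈ Γ, Forces B ρ σ) :
      ∀ B ∈ Γ.map Fm.wkF, Forces B ρ (fun x => Fin.cons (α x) (σ x)) := by
    intro B hB
    obtain ⟨C, hC, rfl⟩ := List.mem_map.1 hB
    exact (forces_wkF ..).2 (hΓ C hC)
  have mono {n m : ℕ} {Γ : List (Fm L₀ n m)} {ρ : Baire → Fin n → ℕ}
      {σ : Baire → Fin m → Baire} {f : Baire → Baire} (hf : Continuous f)
      (hΓ : ∀ B ∈ Γ, Forces B ρ σ) : ∀ B ∈ Γ, Forces B (fun x => ρ (f x)) fun x => σ (f x) :=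
    fun B hB => (hΓ B hB).mono hf
  induction h with
  | ax h =>
    intro ρ σ hρ hσ hΓ
    rw [Fm.ofSentence, forces_subst]
    exact hT _ h _ _
  | hyp h => exact fun hρ hσ hΓ => hΓ _ h
  | botE _ ih => exact fun hρ hσ hΓ => (ih hρ hσ hΓ).elim
  | andI _ _ ih₁ ih₂ => exact fun hρ hσ hΓ => ⟨ih₁ hρ hσ hΓ, ih₂ hρ hσ hΓ⟩
  | andE₁ _ ih => exact fun hρ hσ hΓ => (ih hρ hσ hΓ).1
  | andE₂ _ ih => exact fun hρ hσ hΓ => (ih hρ hσ hΓ).2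
  | orI₁ _ ih =>
    exact fun hρ hσ hΓ => ⟨fun _ => 0, continuous_const, fun f hf _ => (ih hρ hσ hΓ).mono hf,
      fun f hf h => absurd rfl (h 0)⟩
  | orI₂ _ ih =>
    exact fun hρ hσ hΓ => ⟨fun _ => 1, continuous_const, fun f hf h => absurd (h 0) one_ne_zero,
      fun f hf _ => (ih hρ hσ hΓ).mono hf⟩
  | orE _ _ _ ih ih₁ ih₂ =>
    intro ρ σ hρ hσ hΓ
    obtain ⟨k, hk, hA, hB⟩ := ih hρ hσ hΓ
    refine Forces.glue hk fun i f hf hi => ?_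
    by_cases h0 : i = 0
    · exact ih₁ (hρ.comp hf) (hσ.comp hf) (cons (hA f hf fun x => (hi x).trans h0) (mono hf hΓ))
    · exact ih₂ (hρ.comp hf) (hσ.comp hf)
        (cons (hB f hf fun x => (hi x).trans_ne h0) (mono hf hΓ))
  | impI _ ih =>
    exact fun hρ hσ hΓ f hf hA => ih (hρ.comp hf) (hσ.comp hf) (cons hA (mono hf hΓ))
  | impE _ _ ih₁ ih₂ => exact fun hρ hσ hΓ => ih₁ hρ hσ hΓ id continuous_id (ih₂ hρ hσ hΓ)
  | allNI _ ih =>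
    exact fun hρ hσ hΓ f k hf hk =>
      ih (continuous_finCons hk (hρ.comp hf)) (hσ.comp hf) (wkN k (mono hf hΓ))
  | allNE _ t ih =>
    intro ρ σ hρ hσ hΓ
    rw [forces_instN]
    exact ih hρ hσ hΓ id _ continuous_id (t.continuous_val hρ hσ)
  | exNI t _ ih =>
    intro ρ σ hρ hσ hΓ
    exact ⟨_, t.continuous_val hρ hσ, (forces_instN ..).1 (ih hρ hσ hΓ)⟩
  | exNE _ _ ih ih₁ =>
    intro ρ σ hρ hσ hΓ
    obtain ⟨k, hk, hA⟩ := ih hρ hσ hΓ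
    exact (forces_wkN ..).1 (ih₁ (continuous_finCons hk hρ) hσ (cons hA (wkN k hΓ)))
  | allFI _ ih =>
    exact fun hρ hσ hΓ f α hf hα =>
      ih (hρ.comp hf) (continuous_finCons hα (hσ.comp hf)) (wkF α (mono hf hΓ))
  | allFE _ a ih =>
    intro ρ σ hρ hσ hΓ
    rw [forces_instF]
    exact ih hρ hσ hΓ id _ continuous_id ((continuous_apply a).comp hσ)
  | exFI a _ ih =>
    intro ρ σ hρ hσ hΓ
    exact ⟨_, (continuous_apply a).comp hσ, (forces_instF ..).1 (ih hρ hσ hΓ)⟩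
  | exFE _ _ ih ih₁ =>
    intro ρ σ hρ hσ hΓ
    obtain ⟨α, hα, hA⟩ := ih hρ hσ hΓ
    exact (forces_wkF ..).1 (ih₁ hρ (continuous_finCons hα hσ) (cons hA (wkF α hΓ)))
  | eqI t => exact fun hρ hσ hΓ x => rfl
  | eqE A _ _ ih ih₁ =>
    intro ρ σ hρ hσ hΓ
    have h := ih₁ hρ hσ hΓ
    rw [forces_instN] at h ⊢
    simpa only [show ∀ x, _ = _ from ih hρ hσ hΓ] using h

/-- The universal closure of a formula is forced if the formula is forced everywhere. -/
theorem forces_closure : ∀ {n m : ℕ} {A : Fm L₀ n m},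
    (∀ ρ σ, Continuous ρ → Continuous σ → Forces A ρ σ) → ∀ ρ σ, Forces A.closure ρ σ
  | 0, 0, A, h, ρ, σ => by
    rw [A.closure_zero]
    exact h ρ σ (continuous_of_const fun _ _ => Subsingleton.elim _ _)
      (continuous_of_const fun _ _ => Subsingleton.elim _ _)
  | 0, _ + 1, A, h, ρ, σ => by
    rw [A.closure_allF]
    exact forces_closure (A := .allF A) (fun ρ σ hρ hσ f α hf hα =>
      h _ _ (hρ.comp hf) (continuous_finCons hα (hσ.comp hf))) ρ σ
  | _ + 1, _, A, h, ρ, σ => by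
    rw [A.closure_allN]
    exact forces_closure (A := .allN A) (fun ρ σ hρ hσ f k hf hk =>
      h _ _ (continuous_finCons hk (hρ.comp hf)) (hσ.comp hf)) ρ σ

end Forcing

/-! ### The axioms of intuitionistic analysis are forced -/

section Axioms

variable {n m n' m' : ℕ}

theorem forces_subst_iff {A : Fm L₀ n m} {τ : Fin n → Tm L₀ n' m'} {π : Fin m → Fin m'}
    {ρ : Baire → Fin n' → ℕ} {σ : Baire → Fin m' → Baire} {ρ' : Baire → Fin n → ℕ}
    {σ' : Baire → Fin m → Baire} (hρ : ∀ x i, (τ i).val (ρ x) (σ x) = ρ' x i)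
    (hσ : ∀ x j, σ x (π j) = σ' x j) : Forces (A.subst τ π) ρ σ ↔ Forces A ρ' σ' := by
  rw [forces_subst, funext fun x => funext (hρ x), funext fun x => funext (hσ x)]

theorem Tm.val_succT (t : Tm L₀ n m) (ρ : Fin n → ℕ) (σ : Fin m → Baire) :
    (succT t).val ρ σ = t.val ρ σ + 1 := rfl

theorem Tm.val_pr_one (f : PR 1) (t : Tm L₀ n m) (ρ : Fin n → ℕ) (σ : Fin m → Baire) :
    (Tm.pr f ![t]).val ρ σ = f.eval ![t.val ρ σ] := by
  simp only [Tm.val]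
  congr 1
  funext i; fin_cases i; rfl

theorem Tm.val_pr_two (f : PR 2) (t s : Tm L₀ n m) (ρ : Fin n → ℕ) (σ : Fin m → Baire) :
    (Tm.pr f ![t, s]).val ρ σ = f.eval ![t.val ρ σ, s.val ρ σ] := by
  simp only [Tm.val]
  congr 1
  funext i; fin_cases i <;> rfl

theorem forces_neg_eq {t s : Tm L₀ n m} {ρ : Baire → Fin n → ℕ} {σ : Baire → Fin m → Baire} :
    Forces (.neg (.eq t s)) ρ σ ↔ ∀ x, t.val (ρ x) (σ x) ≠ s.val (ρ x) (σ x) :=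
  ⟨fun h x hx => h (fun _ => x) continuous_const fun _ => hx, fun h _ _ hf => h _ (hf 0)⟩

theorem Forces.lt {t s : Tm L₀ n m} {ρ : Baire → Fin n → ℕ} {σ : Baire → Fin m → Baire}
    (h : Forces (ltF t s) ρ σ) (x : Baire) : t.val (ρ x) (σ x) < s.val (ρ x) (σ x) := by
  obtain ⟨k, -, h⟩ := h
  have h := h x
  rw [Tm.val_pr_two, PR.eval_add, Tm.val_wkN, Tm.val_wkN, Tm.val_succT] at h
  omega

theorem forces_lt {t s : Tm L₀ n m} {ρ : Fin n → ℕ} {σ : Fin m → Baire}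
    (h : t.val ρ σ < s.val ρ σ) : Forces (ltF t s) (fun _ => ρ) (fun _ => σ) := by
  refine ⟨fun _ => s.val ρ σ - t.val ρ σ - 1, continuous_const, fun x => ?_⟩
  rw [Tm.val_pr_two, PR.eval_add, Tm.val_wkN, Tm.val_wkN, Tm.val_succT]
  change s.val ρ σ - t.val ρ σ - 1 + 1 + t.val ρ σ = s.val ρ σ
  omega

theorem forces_barF {b : Fin m} {t w : Tm L₀ n m} {ρ : Baire → Fin n → ℕ}
    {σ : Baire → Fin m → Baire} : Forces (barF b t w) ρ σ ↔
      ∀ x, w.val (ρ x) (σ x) = enc (initial (σ x b) (t.val (ρ x) (σ x))) := by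
  have key : ∀ x, w.val (ρ x) (σ x) = enc (initial (σ x b) (t.val (ρ x) (σ x))) ↔
      (dec (w.val (ρ x) (σ x))).length = t.val (ρ x) (σ x) ∧
        ∀ i < t.val (ρ x) (σ x), (dec (w.val (ρ x) (σ x))).getD i 0 = σ x b i := by
    intro x
    rw [← eq_initial_iff]
    exact ⟨fun h => by rw [h, dec_enc], fun h => by rw [← h, enc_dec]⟩
  simp only [key]
  constructor
  · rintro ⟨h₁, h₂⟩ x
    have h₁ := h₁ x
    rw [Tm.val_pr_one, PR.eval_len] at h₁
    refine ⟨h₁, fun i hi => ?_⟩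
    have h₂ := h₂ (fun _ => x) (fun _ => i) continuous_const continuous_const id continuous_id
      (forces_lt (by rw [Tm.val_wkN]; exact hi)) x
    rw [Tm.val_pr_two, Tm.val_wkN, PR.eval_nth] at h₂
    exact h₂
  · intro h
    refine ⟨fun x => ?_, fun f k _ _ g _ hlt x => ?_⟩
    · rw [Tm.val_pr_one, PR.eval_len]
      exact (h x).1
    · have hlt := hlt.lt x
      rw [Tm.val_wkN] at hlt
      rw [Tm.val_pr_two, Tm.val_wkN, PR.eval_nth]
      exact (h _).2 _ hlt

theorem forces_inK0 {a : Fin m} {ρ : Baire → Fin n → ℕ} {σ : Baire → Fin m → Baire}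
    (hσ : Continuous σ)
    (h₁ : ∀ x l l', σ x a (enc l) ≠ 0 → σ x a (enc (l ++ l')) = σ x a (enc l))
    (h₂ : ∀ x α, ∃ k, σ x a (enc (initial α k)) ≠ 0) : Forces (inK0 a) ρ σ := by
  constructor
  · intro f k _ _ f' k' _ _ g _ h x
    have h := forces_neg_eq.1 h x
    change σ (f (f' (g x))) a ((catT (.var 1) (.var 0)).val _ _) = σ (f (f' (g x))) a (k (f' (g x)))
    rw [catT, Tm.val_pr_two, PR.eval_cat]
    refine (h₁ _ _ _ ?_).trans ?_
    · rw [enc_dec]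
      exact h
    · rw [enc_dec]
      rfl
  · intro f α hf hα
    have hγ : Continuous fun x => σ (f x) a := (continuous_apply a).comp (hσ.comp hf)
    obtain ⟨z, hz, hz'⟩ := exists_continuous_choice
      (P := fun x k => σ (f x) a (enc (initial (α x) k)) ≠ 0)
      (fun k => (isClopen_eq
        (continuous_eval (continuous_enc_initial continuous_const hα) hγ) continuous_const).compl)
      fun x => h₂ _ _
    refine ⟨z, hz, fun x => enc (initial (α x) (z x)), continuous_enc_initial hz hα,
      forces_barF.2 fun x => rfl, forces_neg_eq.2 hz'⟩

theorem PrAn1.forces {A : Sentence L₀} (h : A ∈ PrAn1 L₀) (ρ : Baire → Fin 0 → ℕ)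
    (σ : Baire → Fin 0 → Baire) : Forces A ρ σ := by
  cases h <;> refine forces_closure (fun ρ σ hρ hσ => ?_) ρ σ
  case succ_ne_zero => exact forces_neg_eq.2 fun x => Nat.succ_ne_zero _
  case succ_inj => exact fun f hf h x => Nat.succ.inj (h x)
  case identity => exact fun f hf h x => congrArg (σ (f x) 0) (h x)
  case induction A =>
    rintro f hf ⟨h₀, h₁⟩ g k hg hk
    refine Forces.glue hk fun i f' hf' hi => ?_
    simp only [hi]
    clear hi
    induction i with
    | zero => exact ((forces_instN ..).1 h₀).mono (hg.comp hf')
    | succ i ih =>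
      have := h₁ _ _ (hg.comp hf') (continuous_const (y := i)) id continuous_id ih
      refine (forces_subst_iff (fun x j => ?_) fun x j => rfl).1 this
      exact Fin.cases rfl (fun j => rfl) j
  case proj i => exact fun x => rfl
  case comp f g => exact fun x => rfl
  case prec_zero f g =>
    intro x
    refine (congrArg (PR.eval _) ?_).trans (PR.eval_prec_zero f g _)
    funext i
    exact Fin.cases rfl (fun i => rfl) i
  case prec_succ k f g =>
    intro x
    refine (congrArg (PR.eval (PR.prec f g)) ?_).trans
      ((PR.eval_prec_succ f g (ρ x 0) fun i => ρ x i.succ).trans (congrArg g.eval ?_))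
    · funext i
      exact Fin.cases rfl (fun i => rfl) i
    · funext i
      refine Fin.cases rfl (fun i => Fin.cases ?_ (fun i => rfl) i) i
      refine congrArg (PR.eval (PR.prec f g)) ?_
      funext i
      exact Fin.cases rfl (fun i => rfl) i

theorem PrAn2.forces {A : Sentence L₀} (h : A ∈ PrAn2 L₀) (ρ : Baire → Fin 0 → ℕ)
    (σ : Baire → Fin 0 → Baire) : Forces A ρ σ := by
  cases h with
  | mk t =>
    refine forces_closure (fun ρ σ hρ hσ => ?_) ρ σ
    refine ⟨fun x k => t.val (Fin.cons k (ρ x)) (σ x), continuous_pi fun k =>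
      t.continuous_val (continuous_finCons continuous_const hρ) hσ, fun f k hf hk x => ?_⟩
    rw [Tm.val_wkF]
    rfl

/-- Every continuous functional with a parameter has an associate which depends continuously on
the parameter: `Γ x l` is `y + 1` if the initial segment of `x` of the length of `l` and the
initial segment `l` of the argument determine the value `y`, and `0` if they do not determine
the value. -/
theorem exists_associate {k : Baire × Baire → ℕ} (hk : Continuous k) :
    ∃ Γ : Baire → List ℕ → ℕ, (∀ l, Continuous fun x => Γ x l) ∧
      (∀ x α i, Γ x (initial α i) ≠ 0 → Γ x (initial α i) = k (x, α) + 1) ∧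
      (∀ x l l', Γ x l ≠ 0 → Γ x (l ++ l') = Γ x l) ∧
      ∀ x α, ∃ i, Γ x (initial α i) = k (x, α) + 1 := by
  classical
  let ext : List ℕ → Baire := fun l i => l.getD i 0
  have hext : ∀ l, initial (ext l) l.length = l := fun l =>
    (eq_initial_iff.2 ⟨rfl, fun i _ => rfl⟩).symm
  let G : List ℕ → List ℕ → ℕ := fun v l =>
    if ∀ x' α', initial x' l.length = v → initial α' l.length = l →
      k (x', α') = k (ext v, ext l) then k (ext v, ext l) + 1 else 0
  have take : ∀ (α β : Baire) (i j : ℕ), initial α (i + j) = initial β (i + j) →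
      initial α i = initial β i := by
    intro α β i j h
    rw [initial_congr] at h ⊢
    exact fun a ha => h a (by omega)
  have hG : ∀ x l, G (initial x l.length) l ≠ 0 → ∀ x' α',
      initial x' l.length = initial x l.length → initial α' l.length = l →
        G (initial x l.length) l = k (x', α') + 1 := by
    intro x l h x' α' hx hα
    simp only [G] at h ⊢
    split_ifs at h ⊢ with h'
    · rw [h' x' α' hx hα]
    · exact absurd rfl h
  have hG' : ∀ x l y, (∀ x' α', initial x' l.length = initial x l.length →
      initial α' l.length = l → k (x', α') = y) → G (initial x l.length) l = y + 1 := by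
    intro x l y h
    have h₀ : k (ext (initial x l.length), ext l) = y := by
      refine h _ _ ?_ (hext l)
      simpa only [length_initial] using hext (initial x l.length)
    simp only [G, h₀]
    exact if_pos h
  refine ⟨fun x l => G (initial x l.length) l, fun l => ?_, fun x α i h => ?_,
    fun x l l' h => ?_, fun x α => ?_⟩
  · have : Continuous fun x => G (dec (enc (initial x l.length))) l :=
      (continuous_of_discreteTopology (f := fun u : ℕ => G (dec u) l)).comp
        (continuous_enc_initial continuous_const continuous_id)
    simpa only [dec_enc] using this
  · exact hG x _ h x α rfl (by rw [length_initial])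
  · have h' := hG x l h x (ext l) rfl (hext l)
    dsimp only
    rw [h']
    refine hG' _ _ _ fun x' α' hx hα => ?_
    rw [List.length_append] at hx hα
    refine Nat.succ.inj ((hG x l h x' α' (take _ _ _ _ hx) ?_).symm.trans h')
    have := congrArg (List.take l.length) hα
    rwa [List.take_left, take_initial (Nat.le_add_right _ _)] at this
  · obtain ⟨i, hi⟩ := exists_modulus hk x α
    refine ⟨i, hG' _ _ _ fun x' α' hx hα => ?_⟩
    rw [length_initial] at hx hα
    exact hi x' α' hx hα

theorem BCN.forces {A : Sentence L₀} (h : A ∈ BCN L₀) (ρ : Baire → Fin 0 → ℕ)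
    (σ : Baire → Fin 0 → Baire) : Forces A ρ σ := by
  cases h with
  | mk A =>
    refine forces_closure (fun ρ σ hρ hσ f hf h => ?_) ρ σ
    obtain ⟨p, p₁, p₂, hp, hp₁, hp₂, hpp₁, hpp₂⟩ := exists_pairing
    obtain ⟨k, hk, hA⟩ := h p₁ p₂ hp₁ hp₂
    obtain ⟨Γ, hΓ, hΓ₁, hΓ₂, hΓ₃⟩ := exists_associate (hk.comp hp)
    have hγ : Continuous fun x i => Γ x (dec i) := continuous_pi fun i => hΓ _
    refine ⟨_, hγ, forces_inK0 (continuous_finCons hγ (hσ.comp hf)) (fun x l l' => ?_)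
      (fun x α => ?_), ?_⟩
    · simpa only [Fin.cons_zero, dec_enc] using hΓ₂ x l l'
    · obtain ⟨i, hi⟩ := hΓ₃ x α
      refine ⟨i, ?_⟩
      simp only [Fin.cons_zero, dec_enc, hi]
      exact Nat.succ_ne_zero _
    · rintro g α hg hα g' y hg' hy g'' hg'' ⟨z, hz, w, hw, hbar, hval⟩
      rw [forces_barF] at hbar
      have key : ∀ x, y (g'' x) = k (p (g (g' (g'' x))) (α (g' (g'' x)))) := by
        intro x
        have h₁ : y (g'' x) + 1 = Γ (g (g' (g'' x))) (dec (w x)) := hval x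
        have h₂ : w x = enc (initial (α (g' (g'' x))) (z x)) := hbar x
        rw [h₂, dec_enc] at h₁
        have h₃ := hΓ₁ (g (g' (g'' x))) (α (g' (g'' x))) (z x) (by omega)
        exact Nat.succ.inj (h₁.trans h₃)
      refine (forces_subst_iff (ρ' := fun x => Fin.cons (y (g'' x)) (ρ (f (g (g' (g'' x))))))
        (σ' := fun x => Fin.cons (α (g' (g'' x))) (σ (f (g (g' (g'' x))))))
        (fun x i => rfl) fun x j => Fin.cases rfl (fun j => rfl) j).2 ?_
      have := hA.mono (f := fun x => p (g (g' (g'' x))) (α (g' (g'' x))))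
        (hp.comp ((hg.comp (hg'.comp hg'')).prodMk (hα.comp (hg'.comp hg''))))
      simpa only [hpp₁, hpp₂, key] using this

theorem initial_succ_eq_cons (α : Baire) (n : ℕ) :
    initial α (n + 1) = α 0 :: initial (fun i => α (i + 1)) n := by
  simp [initial, List.range_succ_eq_map, Function.comp_def]

theorem BCC.forces {A : Sentence L₀} (h : A ∈ BCC L₀) (ρ : Baire → Fin 0 → ℕ)
    (σ : Baire → Fin 0 → Baire) : Forces A ρ σ := by
  cases h with
  | mk A =>
    refine forces_closure (fun ρ σ hρ hσ f hf h => ?_) ρ σ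
    obtain ⟨p, p₁, p₂, hp, hp₁, hp₂, hpp₁, hpp₂⟩ := exists_pairing
    obtain ⟨β, hβ, hA⟩ := h p₁ p₂ hp₁ hp₂
    choose Γ hΓ hΓ₁ hΓ₂ hΓ₃ using fun i => exists_associate
      (((continuous_apply i).comp hβ).comp hp)
    let γ : Baire → List ℕ → ℕ := fun x l => match l with
      | [] => 0
      | i :: l => Γ i x l
    have hγ : Continuous fun x i => γ x (dec i) := by
      refine continuous_pi fun i => ?_
      match dec i with
      | [] => exact continuous_const
      | i :: l => exact hΓ i l
    refine ⟨_, hγ, forces_inK0 (continuous_finCons hγ (hσ.comp hf)) (fun x l l' => ?_)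
      (fun x α => ?_), ?_⟩
    · simp only [Fin.cons_zero, dec_enc]
      match l with
      | [] => exact fun h => absurd rfl h
      | i :: l => exact hΓ₂ i x l l'
    · obtain ⟨i, hi⟩ := hΓ₃ (α 0) x fun i => α (i + 1)
      refine ⟨i + 1, ?_⟩
      simp only [Fin.cons_zero, dec_enc, initial_succ_eq_cons]
      exact hi.trans_ne (Nat.succ_ne_zero _)
    · intro g α hg hα
      have hq : Continuous fun x => p (g x) (α x) := hp.comp (hg.prodMk hα)
      refine ⟨fun x => β (p (g x) (α x)), hβ.comp hq, ?_, ?_⟩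
      · intro g' i hg' hi
        obtain ⟨z, hz, hz'⟩ := exists_continuous_choice
          (P := fun x k => γ (g (g' x)) (i x :: initial (α (g' x)) k) =
            β (p (g (g' x)) (α (g' x))) (i x) + 1)
          (fun k => by
            refine isClopen_eq ?_ ?_
            · have : Continuous fun x => γ (g (g' x))
                  (dec (PR.cons.eval ![i x, enc (initial (α (g' x)) k)])) := by
                refine continuous_eval ?_ (hγ.comp (hg.comp hg'))
                refine Continuous.eval_pr _ fun j => ?_
                fin_cases j
                · exact hi
                · exact continuous_enc_initial continuous_const (hα.comp hg')
              simpa only [dec_cons, dec_enc] using this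
            · exact continuous_of_discreteTopology (f := fun a : ℕ => a + 1) |>.comp
                (continuous_eval hi (hβ.comp (hq.comp hg'))))
          fun x => hΓ₃ (i x) (g (g' x)) (α (g' x))
        refine ⟨z, hz, fun x => enc (initial (α (g' x)) (z x)),
          continuous_enc_initial hz (hα.comp hg'), forces_barF.2 fun x => rfl, fun x => ?_⟩
        refine (hz' x).symm.trans ?_
        change _ = γ (g (g' x)) (dec ((consT (.var 2) (.var 0)).val _ _))
        rw [consT, Tm.val_pr_two, dec_cons]
        change _ = γ (g (g' x)) (i x :: dec (enc (initial (α (g' x)) (z x))))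
        rw [dec_enc]
      · refine (forces_subst_iff (ρ' := fun x => ρ (f (g x)))
          (σ' := fun x => Fin.cons (β (p (g x) (α x))) (Fin.cons (α x) (σ (f (g x)))))
          (fun x i => rfl)
          fun x j => Fin.cases rfl (fun j => Fin.cases rfl (fun j => rfl) j) j).2 ?_
        simpa only [hpp₁, hpp₂] using hA.mono hq

theorem ACNF.forces {A : Sentence L₀} (h : A ∈ ACNF L₀) (ρ : Baire → Fin 0 → ℕ)
    (σ : Baire → Fin 0 → Baire) : Forces A ρ σ := by
  cases h with
  | mk A =>
    refine forces_closure (fun ρ σ hρ hσ f hf h => ?_) ρ σ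
    -- Baire space is the product of `ℕ` with itself
    let q : ℕ → Baire → Baire := fun k x i => Nat.casesOn i k x
    have hq : Continuous fun p : ℕ × Baire => q p.1 p.2 := by
      refine continuous_pi fun i => ?_
      cases i with
      | zero => exact continuous_fst
      | succ i => exact (continuous_apply i).comp continuous_snd
    obtain ⟨α, hα, hA⟩ := h (fun x i => x (i + 1)) (fun x => x 0) (by fun_prop) (by fun_prop)
    refine ⟨fun x i => α (q (PR.fst.eval ![i]) x) (PR.snd.eval ![i]), continuous_pi fun i =>
      (continuous_apply _).comp (hα.comp (hq.comp (continuous_const.prodMk continuous_id))), ?_⟩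
    intro g k hg hk
    have hqk : Continuous fun x => q (k x) (g x) := hq.comp (hk.prodMk hg)
    refine ⟨fun x => α (q (k x) (g x)), hα.comp hqk, fun g' y hg' hy x => ?_, ?_⟩
    · change α (q (k (g' x)) (g (g' x))) (y x) =
        α (q (PR.fst.eval ![(Tm.pr .pair ![.var 1, .var 0]).val _ _]) (g (g' x)))
          (PR.snd.eval ![(Tm.pr .pair ![.var 1, .var 0]).val _ _])
      rw [Tm.val_pr_two, PR.fst_pair, PR.snd_pair]
      rfl
    · refine (forces_subst_iff (ρ' := fun x => Fin.cons (k x) (ρ (f (g x))))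
        (σ' := fun x => Fin.cons (α (q (k x) (g x))) (σ (f (g x))))
        (fun x i => rfl) fun x j => Fin.cases rfl (fun j => rfl) j).2 ?_
      exact hA.mono hqk

/-- Bar induction, externally. If `A` is not forced on the part of a cylinder where no initial
segment of `l` is in the bar, then the same holds for some extension of the cylinder and some
extension of `l` by one entry each. This gives a parameter `x` and a sequence `α` such that no
initial segment of `α` is in the bar near `x`. -/
theorem BI.forces {A : Sentence L₀} (h : A ∈ BI L₀) (ρ : Baire → Fin 0 → ℕ)
    (σ : Baire → Fin 0 → Baire) : Forces A ρ σ := by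
  cases h with
  | mk R A =>
    refine forces_closure (fun ρ σ hρ hσ => ?_) ρ σ
    rintro f₀ hf₀ ⟨hbar, hdec, hRA, hstep⟩
    replace hρ : Continuous fun x => ρ (f₀ x) := hρ.comp hf₀
    replace hσ : Continuous fun x => σ (f₀ x) := hσ.comp hf₀
    generalize hρ' : (fun x => ρ (f₀ x)) = ρ at *
    generalize hσ' : (fun x => σ (f₀ x)) = σ at *
    clear hρ' hσ' hf₀
    rw [forces_instN]
    -- the bar
    obtain ⟨p, p₁, p₂, hp, hp₁, hp₂, hpp₁, hpp₂⟩ := exists_pairing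
    obtain ⟨z, hz, w, hw, hbar, hR⟩ := hbar p₁ p₂ hp₁ hp₂
    rw [forces_barF] at hbar
    replace hR : Forces R (fun x => Fin.cons (w x) (ρ (p₁ x))) fun x => σ (p₁ x) := by
      refine (forces_subst_iff (fun x i => ?_) fun x j => Fin.cons_succ _ _ j).1 hR
      exact Fin.cases rfl (fun i => rfl) i
    replace hR : ∀ (f : Baire → Baire) (α : Baire), Continuous f →
        Forces R (fun x => Fin.cons (enc (initial α (z (p (f x) α)))) (ρ (f x)))
          fun x => σ (f x) := by
      intro f α hf
      have := hR.mono (f := fun x => p (f x) α) (hp.comp (hf.prodMk continuous_const))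
      have hw' : ∀ x, w x = enc (initial (p₂ x) (z x)) := hbar
      simpa only [hw', hpp₁, hpp₂] using this
    -- the decision of the bar
    choose D hD hD₁ hD₂ using fun l : List ℕ =>
      hdec id (fun _ => enc l) continuous_id continuous_const
    have base : ∀ (l : List ℕ) (f : Baire → Baire), Continuous f → (∀ x, D l (f x) = 0) →
        Forces A (fun x => Fin.cons (enc l) (ρ (f x))) fun x => σ (f x) := fun l f hf h =>
      hRA f (fun _ => enc l) hf continuous_const id continuous_id (hD₁ l f hf h)
    have step : ∀ (l : List ℕ) (f : Baire → Baire), Continuous f →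
        (∀ i, Forces A (fun x => Fin.cons (enc (l ++ [i])) (ρ (f x))) fun x => σ (f x)) →
        Forces A (fun x => Fin.cons (enc l) (ρ (f x))) fun x => σ (f x) := by
      intro l f hf h
      refine hstep f (fun _ => enc l) hf continuous_const id continuous_id ?_
      intro g k hg hk
      refine Forces.glue hk fun i g' hg' hi => ?_
      refine (forces_subst_iff (ρ' := fun x => Fin.cons (enc (l ++ [i])) (ρ (f (g (g' x)))))
        (σ' := fun x => σ (f (g (g' x)))) (fun x j => Fin.cases ?_ (fun j => rfl) j)
        fun x j => rfl).2 ((h i).mono (hg.comp hg'))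
      simp only [Fin.cases_zero, catT, consT, Tm.val_pr_two, PR.eval_cat, dec_cons]
      change enc (dec (enc l) ++ k (g' x) :: dec 0) = enc (l ++ [i])
      rw [dec_enc, dec_zero, hi]
    -- `A` is forced at `l` on the part of `U` where no initial segment of `l` is in the bar
    let P : List ℕ → Set Baire → Prop := fun l U => ∀ f : Baire → Baire, Continuous f →
      (∀ x, f x ∈ U) → (∀ x, ∀ i ≤ l.length, D (l.take i) (f x) ≠ 0) →
        Forces A (fun x => Fin.cons (enc l) (ρ (f x))) fun x => σ (f x)
    let C : List ℕ → Set Baire := fun v => {x | initial x v.length = v}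
    have hP : ∀ l U, (∀ j, P (l ++ [j]) U) → P l U := by
      intro l U h f hf hU hl
      refine step l f hf fun j => Forces.glue ((hD (l ++ [j])).comp hf) fun i f' hf' hi => ?_
      by_cases h0 : i = 0
      · exact base _ _ (hf.comp hf') fun x => (hi x).trans h0
      · refine h j _ (hf.comp hf') (fun x => hU _) fun x i' hi' => ?_
        rw [List.length_append, List.length_singleton] at hi'
        rcases Nat.lt_or_eq_of_le hi' with hlt | rfl
        · rw [List.take_append_of_le_length (by omega)]
          exact hl _ i' (by omega)
        · rw [List.take_of_length_le (by simp)]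
          exact (hi x).trans_ne h0
    have hPC : ∀ l v, (∀ i, P l (C (v ++ [i]))) → P l (C v) := by
      intro l v h f hf hU hl
      refine Forces.glue ((continuous_apply v.length).comp hf) fun i f' hf' hi => ?_
      refine h i _ (hf.comp hf') (fun x => ?_) fun x => hl _
      change initial _ (v ++ [i]).length = v ++ [i]
      rw [List.length_append, List.length_singleton, initial_succ, show initial _ _ = v from hU _]
      exact congrArg (fun a => v ++ [a]) (hi x)
    have root : P [] (C []) → Forces A (fun x => Fin.cons (enc []) (ρ x)) σ := by
      intro h
      refine Forces.glue (hD []) fun i f hf hi => ?_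
      by_cases h0 : i = 0
      · exact base _ _ hf fun x => (hi x).trans h0
      · refine h f hf (fun x => rfl) fun x i' _ => ?_
        rw [List.take_nil]
        exact (hi x).trans_ne h0
    refine root ?_
    by_contra hn
    have ex : ∀ s : List ℕ × List ℕ, ∃ a : ℕ × ℕ, ¬ P s.2 (C s.1) →
        ¬ P (s.2 ++ [a.2]) (C (s.1 ++ [a.1])) := by
      intro s
      by_contra! h
      have hs : ¬ P s.2 (C s.1) := (h (0, 0)).1
      exact hs (hPC _ _ fun i => hP _ _ fun j => (h (i, j)).2)
    choose F hF using ex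
    let st : ℕ → List ℕ × List ℕ := fun k =>
      Nat.rec ([], []) (fun _ s => (s.1 ++ [(F s).1], s.2 ++ [(F s).2])) k
    have hst : ∀ k, ¬ P (st k).2 (C (st k).1) := by
      intro k
      induction k with
      | zero => exact hn
      | succ k ih => exact hF _ ih
    let x : Baire := fun k => (F (st k)).1
    let α : Baire := fun k => (F (st k)).2
    have hst' : ∀ k, st k = (initial x k, initial α k) := by
      intro k
      induction k with
      | zero => rfl
      | succ k ih =>
        have : st (k + 1) = ((st k).1 ++ [x k], (st k).2 ++ [α k]) := rfl
        rw [this, ih, initial_succ, initial_succ]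
    obtain ⟨N, hN⟩ := exists_modulus (hz.comp hp) x α
    have := hst (max N (z (p x α)))
    rw [hst'] at this
    refine this fun f hf hU hl => False.elim ?_
    have hfx : ∀ y, z (p (f y) α) = z (p x α) := by
      intro y
      refine hN (f y) α ?_ rfl
      have := hU y
      simp only [C, Set.mem_ofPred_eq, length_initial] at this
      rw [initial_congr] at this ⊢
      exact fun i hi => this i (lt_max_of_lt_left hi)
    have hRf := hR f α hf
    simp only [hfx] at hRf
    refine hD₂ (initial α (z (p x α))) f hf (fun y => ?_) id continuous_id hRf
    have := hl y (z (p x α)) (by rw [length_initial]; exact le_max_right _ _)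
    simpa only [take_initial (le_max_right _ _)] using this

theorem GMP.forces (ρ : Baire → Fin 0 → ℕ) (σ : Baire → Fin 0 → Baire) : Forces GMP ρ σ := by
  intro f α hf hα g hg h
  obtain ⟨k, hk, hk'⟩ := exists_continuous_choice (P := fun x k => α (g x) k = 0)
    (fun k => isClopen_eq ((continuous_apply k).comp (hα.comp hg)) continuous_const) fun x => by
      by_contra hx
      refine h (fun _ => x) continuous_const fun f' hf' hex => ?_
      obtain ⟨k, -, hk⟩ := hex
      exact hx ⟨_, hk 0⟩
  exact ⟨k, hk, hk'⟩

/-- Intuitionistic analysis with the general form of Markov's principle is consistent. -/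
theorem consistent_insert_GMP_FIM : Consistent (insert GMP FIM) := by
  intro h
  refine h.forces (fun A hA => ?_) (ρ := fun _ i => i.elim0) (σ := fun _ j => j.elim0)
    continuous_const continuous_const (fun B hB => absurd hB List.not_mem_nil)
  rcases hA with rfl | ((((hA | hA) | hA) | hA) | hA) | hA
  · exact GMP.forces
  · exact PrAn1.forces hA
  · exact PrAn2.forces hA
  · exact BCN.forces hA
  · exact ACNF.forces hA
  · exact BI.forces hA
  · exact BCC.forces hA

end Axioms

/-! ### Substitution in the abbreviations -/

section Abbreviations

variable {L L' : Lang} {n m n' m' : ℕ} (σ : Fin n → Tm L n' m') (ρ : Fin m → Fin m')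

theorem Tm.var_subst (i : Fin n) : (Tm.var i).subst σ ρ = σ i := rfl

theorem Tm.app_subst (a : Fin m) (t : Tm L n m) :
    (Tm.app a t).subst σ ρ = .app (ρ a) (t.subst σ ρ) := rfl

theorem upN_zero : upN σ 0 = .var 0 := rfl

theorem upN_one (σ : Fin (n + 1) → Tm L n' m') : upN σ 1 = (σ 0).wkN := rfl

theorem Tm.subst_pr_zero (f : PR 0) : (Tm.pr f ![]).subst σ ρ = Tm.pr f ![] := by
  simp only [Tm.subst]
  congr 1
  exact funext fun i => i.elim0

theorem Tm.subst_pr_one (f : PR 1) (t : Tm L n m) :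
    (Tm.pr f ![t]).subst σ ρ = Tm.pr f ![t.subst σ ρ] := by
  simp only [Tm.subst]
  congr 1
  funext i; fin_cases i; rfl

theorem Tm.subst_pr_two (f : PR 2) (t s : Tm L n m) :
    (Tm.pr f ![t, s]).subst σ ρ = Tm.pr f ![t.subst σ ρ, s.subst σ ρ] := by
  simp only [Tm.subst]
  congr 1
  funext i; fin_cases i <;> rfl

theorem Tm.subst_wkN (t : Tm L n m) : t.wkN.subst (upN σ) ρ = (t.subst σ ρ).wkN := by
  simp only [Tm.wkN, Tm.subst_subst]; rfl

theorem Tm.subst_zeroT : (zeroT : Tm L n m).subst σ ρ = zeroT := Tm.subst_pr_zero ..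

theorem Tm.subst_succT (t : Tm L n m) : (succT t).subst σ ρ = succT (t.subst σ ρ) :=
  Tm.subst_pr_one ..

theorem Fm.subst_neg (A : Fm L n m) : A.neg.subst σ ρ = (A.subst σ ρ).neg := rfl

theorem Fm.subst_ltF (t s : Tm L n m) : (ltF t s).subst σ ρ = ltF (t.subst σ ρ) (s.subst σ ρ) := by
  simp only [ltF, Fm.subst, Tm.subst_pr_two, Tm.subst_succT, Tm.subst_wkN]
  rfl

theorem Fm.subst_barF (b : Fin m) (t w : Tm L n m) :
    (barF b t w).subst σ ρ = barF (ρ b) (t.subst σ ρ) (w.subst σ ρ) := by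
  simp only [barF, Fm.subst, Tm.subst_pr_one, Tm.subst_pr_two, Fm.subst_ltF, Tm.subst_wkN]
  rfl

theorem Fm.subst_valF (c b : Fin m) (y : Tm L n m) :
    (valF c b y).subst σ ρ = valF (ρ c) (ρ b) (y.subst σ ρ) := by
  simp only [valF, Fm.subst, Fm.subst_barF, Tm.subst_succT, Tm.subst_wkN]
  rfl

theorem Fm.subst_inK0 (a : Fin m) : (inK0 a : Fm L n m).subst σ ρ = inK0 (ρ a) := by
  simp only [inK0, catT, Fm.subst, Fm.subst_neg, Fm.subst_barF, Tm.subst_zeroT, Tm.app_subst,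
    Tm.subst_pr_two]
  rfl

variable (s : ∀ k l : ℕ, L.Sym k l → L'.Sym k l) (b : L.Box → L'.Box)

theorem Tm.map_app (a : Fin m) (t : Tm L n m) : (Tm.app a t).map s = .app a (t.map s) := rfl

theorem Tm.map_pr_zero (f : PR 0) : (Tm.pr f ![] : Tm L n m).map s = Tm.pr f ![] := by
  simp only [Tm.map]
  congr 1
  exact funext fun i => i.elim0

theorem Tm.map_pr_one (f : PR 1) (t : Tm L n m) :
    (Tm.pr f ![t]).map s = Tm.pr f ![t.map s] := by
  simp only [Tm.map]
  congr 1
  funext i; fin_cases i; rfl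

theorem Tm.map_pr_two (f : PR 2) (t u : Tm L n m) :
    (Tm.pr f ![t, u]).map s = Tm.pr f ![t.map s, u.map s] := by
  simp only [Tm.map]
  congr 1
  funext i; fin_cases i <;> rfl

theorem Tm.map_zeroT : (zeroT : Tm L n m).map s = zeroT := Tm.map_pr_zero ..

theorem Tm.map_succT (t : Tm L n m) : (succT t).map s = succT (t.map s) := Tm.map_pr_one ..

theorem Fm.map_neg (A : Fm L n m) : A.neg.map s b = (A.map s b).neg := rfl

theorem Fm.map_ltF (t u : Tm L n m) : (ltF t u).map s b = ltF (t.map s) (u.map s) := by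
  simp only [ltF, Fm.map, Tm.map_pr_two, Tm.map_succT, Tm.map_wkN]
  rfl

theorem Fm.map_barF (a : Fin m) (t w : Tm L n m) :
    (barF a t w).map s b = barF a (t.map s) (w.map s) := by
  simp only [barF, Fm.map, Tm.map_pr_one, Tm.map_pr_two, Fm.map_ltF, Tm.map_wkN]
  rfl

theorem Fm.map_valF (c a : Fin m) (y : Tm L n m) :
    (valF c a y).map s b = valF c a (y.map s) := by
  simp only [valF, Fm.map, Fm.map_barF, Tm.map_succT, Tm.map_wkN]
  rfl

theorem Fm.map_inK0 (a : Fin m) : (inK0 a : Fm L n m).map s b = inK0 a := by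
  simp only [inK0, catT, Fm.map, Fm.map_neg, Fm.map_barF, Tm.map_zeroT, Tm.map_app,
    Tm.map_pr_two]
  rfl

end Abbreviations

/-! ### Derived rules -/

section Rules

variable {L : Lang} {T : Theory L} {n m : ℕ} {Γ : List (Fm L n m)}

theorem Prov.wkN {A : Fm L n m} (h : Prov T Γ A) (B : Fm L (n + 1) m) :
    Prov T (B :: Γ.map Fm.wkN) A.wkN :=
  h.subst _ _ fun _ hC => List.mem_cons_of_mem _ (List.mem_map_of_mem hC)

theorem Prov.wkF {A : Fm L n m} (h : Prov T Γ A) (B : Fm L n (m + 1)) :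
    Prov T (B :: Γ.map Fm.wkF) A.wkF :=
  h.subst _ _ fun _ hC => List.mem_cons_of_mem _ (List.mem_map_of_mem hC)

theorem Prov.wk {A : Fm L n m} (h : Prov T Γ A) (B : Fm L n m) : Prov T (B :: Γ) A :=
  h.weaken (List.subset_cons_self _ _)

theorem Prov.here {A : Fm L n m} : Prov T (A :: Γ) A := .hyp List.mem_cons_self

theorem Prov.not_not_map {A B : Fm L n m} (h : Prov T Γ A.neg.neg) (h' : Prov T (A :: Γ) B) :
    Prov T Γ B.neg.neg := by
  refine .impI (.impE (h.wk _) (.impI (.impE (Prov.here.wk _) ?_)))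
  exact h'.weaken fun C hC => by
    rcases List.mem_cons.1 hC with rfl | hC
    · exact List.mem_cons_self
    · exact List.mem_cons_of_mem _ (List.mem_cons_of_mem _ hC)

theorem Prov.not_not_join {A : Fm L n m} (h : Prov T Γ A.neg.neg.neg.neg) :
    Prov T Γ A.neg.neg :=
  .impI (.impE (h.wk _) (.impI (.impE .here (Prov.here.wk _))))

theorem Prov.not_not_em (A : Fm L n m) : Prov T Γ (Fm.or A A.neg).neg.neg :=
  .impI (.impE .here (.orI₂ (.impI (.impE (Prov.here.wk _) (.orI₁ .here)))))

theorem Prov.eq_congr {t s : Tm L n m} (u : Tm L (n + 1) m) (h : Prov T Γ (.eq t s)) :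
    Prov T Γ (.eq (u.subst (Fin.cases t .var) id) (u.subst (Fin.cases s .var) id)) := by
  have := Prov.eqE (.eq (u.subst (Fin.cases t .var) id).wkN u) h
    (by simp only [Fm.instN, Fm.subst, Tm.wkN_subst_cases]; exact .eqI _)
  simpa only [Fm.instN, Fm.subst, Tm.wkN_subst_cases, Tm.var_subst, Fin.cases_zero] using this

theorem Prov.eq_symm {t s : Tm L n m} (h : Prov T Γ (.eq t s)) : Prov T Γ (.eq s t) := by
  have := Prov.eqE (.eq (.var 0) t.wkN) h
    (by simp only [Fm.instN, Fm.subst, Tm.wkN_subst_cases]; exact .eqI _)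
  simpa only [Fm.instN, Fm.subst, Tm.wkN_subst_cases, Tm.var_subst, Fin.cases_zero] using this

theorem Prov.eq_trans {t s u : Tm L n m} (h : Prov T Γ (.eq t s)) (h' : Prov T Γ (.eq s u)) :
    Prov T Γ (.eq t u) := by
  have := Prov.eqE (.eq t.wkN (.var 0)) h'
    (by simp only [Fm.instN, Fm.subst, Tm.wkN_subst_cases]; exact h)
  simpa only [Fm.instN, Fm.subst, Tm.wkN_subst_cases, Tm.var_subst, Fin.cases_zero] using this

theorem Prov.pr_one {t s : Tm L n m} (f : PR 1) (h : Prov T Γ (.eq t s)) :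
    Prov T Γ (.eq (.pr f ![t]) (.pr f ![s])) := by
  simpa only [Tm.subst_pr_one, Tm.var_subst, Fin.cases_zero] using h.eq_congr (.pr f ![.var 0])

theorem Prov.pr_left {t s : Tm L n m} (f : PR 2) (u : Tm L n m) (h : Prov T Γ (.eq t s)) :
    Prov T Γ (.eq (.pr f ![t, u]) (.pr f ![s, u])) := by
  simpa only [Tm.subst_pr_two, Tm.wkN_subst_cases, Tm.var_subst, Fin.cases_zero] using h.eq_congr (.pr f ![.var 0, u.wkN])

end Rules

/-! ### Some formal arithmetic -/

section Arithmetic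

variable {L : Lang} {T : Theory L} {n m : ℕ} {Γ : List (Fm L n m)}

theorem Prov.succ_ne_zero (hT : PrAn1 L ⊆ T) (t : Tm L n m) :
    Prov T Γ (.neg (.eq (succT t) zeroT)) := by
  have := Prov.inst (Γ := Γ) (hT PrAn1.succ_ne_zero) ![t] Fin.elim0
  simp only [Fm.subst_neg, Fm.subst, Tm.subst_succT, Tm.subst_zeroT] at this
  exact this

theorem Prov.induction (hT : PrAn1 L ⊆ T) (A : Fm L (n + 1) m)
    (h₀ : Prov T Γ (A.instN zeroT))
    (h₁ : Prov T (A :: Γ.map Fm.wkN)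
      (A.subst (Fin.cases (succT (.var 0)) fun i => .var i.succ) id))
    (t : Tm L n m) : Prov T Γ (A.instN t) := by
  have := Prov.inst (Γ := Γ) (hT (PrAn1.induction A)) .var id
  rw [Fm.subst_var] at this
  exact (this.impE (.andI h₀ (.allNI (.impI h₁)))).allNE t

theorem Prov.pr_proj (hT : PrAn1 L ⊆ T) {k : ℕ} (i : Fin k) (ts : Fin k → Tm L n m) :
    Prov T Γ (.eq (.pr (.proj i) ts) (ts i)) :=
  Prov.inst (hT (PrAn1.proj i)) ts Fin.elim0

theorem Prov.pr_comp (hT : PrAn1 L ⊆ T) {j k : ℕ} (f : PR j) (g : Fin j → PR k)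
    (ts : Fin k → Tm L n m) :
    Prov T Γ (.eq (.pr (.comp f g) ts) (.pr f fun i => .pr (g i) ts)) :=
  Prov.inst (hT (PrAn1.comp f g)) ts Fin.elim0

theorem Tm.subst_finCons {n' m' k : ℕ} (σ : Fin n → Tm L n' m') (ρ : Fin m → Fin m')
    (t : Tm L n m) (ts : Fin k → Tm L n m) :
    (fun i => (Fin.cons (α := fun _ => Tm L n m) t ts i).subst σ ρ) =
      Fin.cons (t.subst σ ρ) fun i => (ts i).subst σ ρ := by
  funext i
  exact Fin.cases rfl (fun i => rfl) i

theorem Prov.pr_prec_zero (hT : PrAn1 L ⊆ T) {k : ℕ} (f : PR k) (g : PR (k + 2))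
    (ts : Fin k → Tm L n m) :
    Prov T Γ (.eq (.pr (.prec f g) (Fin.cons zeroT ts)) (.pr f ts)) := by
  have := Prov.inst (Γ := Γ) (hT (PrAn1.prec_zero f g)) ts Fin.elim0
  simp only [Fm.subst, Tm.subst, Tm.subst_finCons, Tm.subst_zeroT] at this
  exact this

theorem Prov.pr_prec_succ (hT : PrAn1 L ⊆ T) {k : ℕ} (f : PR k) (g : PR (k + 2))
    (t : Tm L n m) (ts : Fin k → Tm L n m) :
    Prov T Γ (.eq (.pr (.prec f g) (Fin.cons (succT t) ts))
      (.pr g (Fin.cons t (Fin.cons (.pr (.prec f g) (Fin.cons t ts)) ts)))) := by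
  have := Prov.inst (Γ := Γ) (hT (PrAn1.prec_succ f g)) (Fin.cons t ts) Fin.elim0
  simp only [Fm.subst, Tm.subst, Tm.subst_finCons, Tm.subst_succT] at this
  exact this

theorem Prov.pred_zero (hT : PrAn1 L ⊆ T) :
    Prov T Γ (.eq (.pr .pred ![zeroT]) zeroT) :=
  Prov.pr_prec_zero hT .zero (.proj 0) ![]

theorem Prov.pred_succ (hT : PrAn1 L ⊆ T) (t : Tm L n m) :
    Prov T Γ (.eq (.pr .pred ![succT t]) t) :=
  (Prov.pr_prec_succ hT .zero (.proj 0) t ![]).eq_trans (Prov.pr_proj hT 0 _)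

theorem Prov.zero_add (hT : PrAn1 L ⊆ T) (t : Tm L n m) :
    Prov T Γ (.eq (.pr .add ![zeroT, t]) t) :=
  (Prov.pr_prec_zero hT (.proj 0) _ ![t]).eq_trans (Prov.pr_proj hT 0 _)

theorem Prov.succ_add (hT : PrAn1 L ⊆ T) (t s : Tm L n m) :
    Prov T Γ (.eq (.pr .add ![succT t, s]) (succT (.pr .add ![t, s]))) := by
  refine (Prov.pr_prec_succ hT (.proj 0) (.comp .succ ![.proj 1]) t ![s]).eq_trans
    ((Prov.pr_comp hT _ _ _).eq_trans ?_)
  have : (fun i => Tm.pr (![PR.proj 1] i : PR 3) ![t, .pr .add ![t, s], s]) =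
      ![.pr (.proj 1) ![t, .pr .add ![t, s], s]] := by
    funext i; fin_cases i; rfl
  refine (?_ : Prov T Γ (.eq (.pr .succ fun i => Tm.pr (![PR.proj 1] i : PR 3)
    ![t, .pr .add ![t, s], s]) _))
  rw [this]
  exact (Prov.pr_proj hT _ _).pr_one .succ

/-- The function `(y, x) ↦ x ∸ y`. -/
def PR.monus : PR 2 := .prec (.proj 0) (.comp .pred ![.proj 1])

theorem Prov.monus_zero (hT : PrAn1 L ⊆ T) (t : Tm L n m) :
    Prov T Γ (.eq (.pr .monus ![zeroT, t]) t) :=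
  (Prov.pr_prec_zero hT (.proj 0) _ ![t]).eq_trans (Prov.pr_proj hT 0 _)

theorem Prov.monus_succ (hT : PrAn1 L ⊆ T) (t s : Tm L n m) :
    Prov T Γ (.eq (.pr .monus ![succT t, s]) (.pr .pred ![.pr .monus ![t, s]])) := by
  refine (Prov.pr_prec_succ hT (.proj 0) (.comp .pred ![.proj 1]) t ![s]).eq_trans
    ((Prov.pr_comp hT _ _ _).eq_trans ?_)
  have : (fun i => Tm.pr (![PR.proj 1] i : PR 3) ![t, .pr .monus ![t, s], s]) =
      ![.pr (.proj 1) ![t, .pr .monus ![t, s], s]] := by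
    funext i; fin_cases i; rfl
  refine (?_ : Prov T Γ (.eq (.pr .pred fun i => Tm.pr (![PR.proj 1] i : PR 3)
    ![t, .pr .monus ![t, s], s]) _))
  rw [this]
  exact (Prov.pr_proj hT _ _).pr_one .pred

theorem Tm.wkN_subst_succ (s : Tm L n m) :
    s.wkN.subst (Fin.cases (succT (.var 0)) fun i => .var i.succ) id = s.wkN := by
  simp only [Tm.wkN, Tm.subst_subst]
  rfl

theorem Prov.monus_succ_succ (hT : PrAn1 L ⊆ T) (t s : Tm L n m) :
    Prov T Γ (.eq (.pr .monus ![succT t, succT s]) (.pr .monus ![t, s])) := by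
  have := Prov.induction (Γ := Γ) hT
    (.eq (.pr .monus ![succT (.var 0), succT s.wkN]) (.pr .monus ![.var 0, s.wkN])) ?_ ?_ t
  · simpa only [Fm.instN, Fm.subst, Tm.subst_pr_two, Tm.subst_succT, Tm.var_subst,
      Fin.cases_zero, Tm.wkN_subst_cases] using this
  · simp only [Fm.instN, Fm.subst, Tm.subst_pr_two, Tm.subst_succT, Tm.var_subst,
      Fin.cases_zero, Tm.wkN_subst_cases]
    exact (Prov.monus_succ hT _ _).eq_trans (((Prov.monus_zero hT _).pr_one _).eq_trans
      ((Prov.pred_succ hT _).eq_trans (Prov.monus_zero hT _).eq_symm))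
  · simp only [Fm.subst, Tm.subst_pr_two, Tm.subst_succT, Tm.var_subst,
      Fin.cases_zero, Tm.wkN_subst_succ]
    exact (Prov.monus_succ hT _ _).eq_trans
      ((Prov.here.pr_one _).eq_trans (Prov.monus_succ hT _ _).eq_symm)

theorem Prov.monus_self_succ (hT : PrAn1 L ⊆ T) (t : Tm L n m) :
    Prov T Γ (.eq (.pr .monus ![t, succT t]) (succT zeroT)) := by
  have := Prov.induction (Γ := Γ) hT
    (.eq (.pr .monus ![.var 0, succT (.var 0)]) (succT zeroT)) ?_ ?_ t
  · simpa only [Fm.instN, Fm.subst, Tm.subst_pr_two, Tm.subst_succT, Tm.var_subst,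
      Fin.cases_zero, Tm.subst_zeroT] using this
  · simp only [Fm.instN, Fm.subst, Tm.subst_pr_two, Tm.subst_succT, Tm.var_subst,
      Fin.cases_zero, Tm.subst_zeroT]
    exact Prov.monus_zero hT _
  · simp only [Fm.subst, Tm.subst_pr_two, Tm.subst_succT, Tm.var_subst,
      Fin.cases_zero, Tm.subst_zeroT]
    exact (Prov.monus_succ_succ hT _ _).eq_trans .here

theorem Prov.monus_add (hT : PrAn1 L ⊆ T) (t s : Tm L n m) :
    Prov T Γ (.eq (.pr .monus ![.pr .add ![succT t, s], succT s]) zeroT) := by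
  have := Prov.induction (Γ := Γ) hT
    (.eq (.pr .monus ![.pr .add ![succT (.var 0), s.wkN], succT s.wkN]) zeroT) ?_ ?_ t
  · simpa only [Fm.instN, Fm.subst, Tm.subst_pr_two, Tm.subst_succT, Tm.var_subst,
      Fin.cases_zero, Tm.subst_zeroT, Tm.wkN_subst_cases] using this
  · simp only [Fm.instN, Fm.subst, Tm.subst_pr_two, Tm.subst_succT, Tm.var_subst,
      Fin.cases_zero, Tm.subst_zeroT, Tm.wkN_subst_cases]
    refine (Prov.pr_left _ _ ((Prov.succ_add hT _ _).eq_trans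
      ((Prov.zero_add hT _).pr_one .succ))).eq_trans ?_
    exact (Prov.monus_succ hT _ _).eq_trans (((Prov.monus_self_succ hT _).pr_one _).eq_trans
      (Prov.pred_succ hT _))
  · simp only [Fm.subst, Tm.subst_pr_two, Tm.subst_succT, Tm.var_subst,
      Fin.cases_zero, Tm.subst_zeroT, Tm.wkN_subst_succ]
    refine (Prov.pr_left _ _ (Prov.succ_add hT _ _)).eq_trans ?_
    exact (Prov.monus_succ hT _ _).eq_trans ((Prov.here.pr_one _).eq_trans (Prov.pred_zero hT))

theorem Prov.exists_eq_succ (hT : PrAn1 L ⊆ T) {t : Tm L n m}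
    (h : Prov T Γ (.neg (.eq t zeroT))) : Prov T Γ (.exN (.eq (succT (.var 0)) t.wkN)) := by
  have := Prov.induction (Γ := Γ) hT
    (.imp (.neg (.eq (.var 0) zeroT)) (.exN (.eq (succT (.var 0)) (.var 1)))) ?_ ?_ t
  · simp only [Fm.instN, Fm.subst, Fm.subst_neg, Tm.subst_succT, Tm.var_subst, Fin.cases_zero,
      Tm.subst_zeroT, upN_zero, upN_one] at this
    exact .impE this h
  · simp only [Fm.instN, Fm.subst, Fm.subst_neg, Tm.var_subst, Fin.cases_zero, Tm.subst_zeroT]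
    exact .impI (.botE (.impE .here (.eqI _)))
  · simp only [Fm.subst, Tm.subst_succT, Tm.var_subst, Fin.cases_zero, upN_zero, upN_one]
    refine .impI (.exNI (.var 0) ?_)
    simp only [Fm.instN, Fm.subst, Tm.subst_succT, Tm.var_subst, Fin.cases_zero,
      Tm.wkN_subst_cases]
    exact .eqI _

end Arithmetic

/-! ### The creating subject refutes Markov's principle -/

section Markov

/-- The formula `∃ x, a(x) = 0`. -/
def hasZero {L : Lang} {n m : ℕ} (a : Fin m) : Fm L n m := .exN (.eq (.app a (.var 0)) zeroT)

/-- The formula `∀ x, a(x) = 0`. -/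
def isZero {L : Lang} {n m : ℕ} (a : Fin m) : Fm L n m := .allN (.eq (.app a (.var 0)) zeroT)

/-- The formula `∀ x, a(x) = 0 ∨ ¬ ∀ x, a(x) = 0`. -/
def decZero {L : Lang} {n m : ℕ} (a : Fin m) : Fm L n m := .or (isZero a) (isZero a).neg

/-- The formula `(t = 0 → ∀ x, a(x) = 0) ∧ (∀ x, a(x) = 0 → t = 0)`. -/
def tests {L : Lang} {n m : ℕ} (t : Tm L n m) (a : Fin m) : Fm L n m :=
  .and (.imp (.eq t zeroT) (isZero a)) (.imp (isZero a) (.eq t zeroT))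

section Substitution

variable {L L' : Lang} {n m n' m' : ℕ} (σ : Fin n → Tm L n' m') (ρ : Fin m → Fin m')

theorem Fm.subst_hasZero (a : Fin m) : (hasZero a : Fm L n m).subst σ ρ = hasZero (ρ a) := by
  simp only [hasZero, Fm.subst, Tm.app_subst, Tm.subst_zeroT]
  rfl

theorem Fm.subst_isZero (a : Fin m) : (isZero a : Fm L n m).subst σ ρ = isZero (ρ a) := by
  simp only [isZero, Fm.subst, Tm.app_subst, Tm.subst_zeroT]
  rfl

theorem Fm.subst_decZero (a : Fin m) : (decZero a : Fm L n m).subst σ ρ = decZero (ρ a) := by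
  simp only [decZero, Fm.subst, Fm.subst_neg, Fm.subst_isZero]

theorem Fm.subst_tests (t : Tm L n m) (a : Fin m) :
    (tests t a).subst σ ρ = tests (t.subst σ ρ) (ρ a) := by
  simp only [tests, Fm.subst, Fm.subst_isZero, Tm.subst_zeroT]

variable (s : ∀ k l : ℕ, L.Sym k l → L'.Sym k l) (b : L.Box → L'.Box)

theorem Fm.map_hasZero (a : Fin m) : (hasZero a : Fm L n m).map s b = hasZero a := by
  simp only [hasZero, Fm.map, Tm.map_app, Tm.map_zeroT]
  rfl

theorem Fm.map_isZero (a : Fin m) : (isZero a : Fm L n m).map s b = isZero a := by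
  simp only [isZero, Fm.map, Tm.map_app, Tm.map_zeroT]
  rfl

theorem Fm.map_decZero (a : Fin m) : (decZero a : Fm L n m).map s b = decZero a := by
  simp only [decZero, Fm.map, Fm.map_neg, Fm.map_isZero]

theorem Fm.map_tests (t : Tm L n m) (a : Fin m) :
    (tests t a).map s b = tests (t.map s) a := by
  simp only [tests, Fm.map, Fm.map_isZero, Tm.map_zeroT]

end Substitution

/-- The theory of the creating subject. -/
abbrev TCS : Theory LK := FIM₀plus ∪ CS

theorem PrAn1_subset_TCS : PrAn1 LK ⊆ TCS := fun _ h => .inl (.inl (.inl (.inl h)))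

/-- The sentence `GMP`, in any variables. -/
def gmp {n m : ℕ} : Fm LK n m := .allF (.imp (hasZero 0).neg.neg (hasZero 0))

theorem Fm.subst_gmp {n m n' m' : ℕ} (σ : Fin n → Tm LK n' m') (ρ : Fin m → Fin m') :
    (gmp : Fm LK n m).subst σ ρ = gmp := by
  simp only [gmp, Fm.subst, Fm.subst_neg, Fm.subst_hasZero]
  rfl

theorem toLK_GMP : GMP.toLK = gmp := by
  have h : (hasZero 0 : Fm L₀ 0 1).toLK = hasZero 0 := Fm.map_hasZero _ _ 0
  exact congrArg (fun A : Fm LK 0 1 => Fm.allF (.imp A.neg.neg A)) h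

/-- The formula `□_x (∀ y, α(y) = 0 ∨ ¬ ∀ y, α(y) = 0) → ⊥`. -/
def notBox : Fm LBox 1 1 := .imp (.box trivial (.var 0) (decZero 0)) .bot

theorem extDelta_notBox : ExtDelta notBox := by
  have := ExtDelta.box (0 : Fin 1) (decZero 0 : Fm LBox 0 1)
  rw [Fm.subst_decZero] at this
  exact .imp this .bot

variable {n m : ℕ} {Γ : List (Fm LK n m)}

/-- The characteristic function of `¬ □_t (∀ y, a(y) = 0 ∨ ¬ ∀ y, a(y) = 0)`. -/
def chiNotBox (t : Tm LK n m) (a : Fin m) : Tm LK n m :=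
  .sym (L := LK) ⟨notBox, extDelta_notBox⟩ (fun _ => t) fun _ => a

theorem Prov.chi (t : Tm LK n m) (a : Fin m) : Prov TCS Γ
    (.iff (.eq (chiNotBox t a) zeroT) (boxF t (decZero a)).neg.neg) := by
  have := (Prov.inst (T := TCS) (Γ := Γ)
    (.inl (.inl (.inl (.inr (ChiAx.mk _ extDelta_notBox))))) (fun _ => t) fun _ => a).andE₂
  have hbox : notBox.boxToLK = (boxF (.var 0) (decZero 0)).neg :=
    congrArg (fun A => (boxF (.var 0) A).neg) (Fm.map_decZero _ _ 0)
  rw [hbox] at this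
  simp only [Fm.iff, Fm.subst, Fm.subst_neg, Tm.subst_zeroT, boxF, Fm.subst_decZero] at this
  exact this

theorem Prov.cs1 (t : Tm LK n m) (a : Fin m) : Prov TCS Γ
    (.or (boxF t (decZero a)) (boxF t (decZero a)).neg) := by
  have := (Prov.inst (T := TCS) (Γ := Γ)
    (.inr (CS.cs1 (n := 0) (decZero 0 : Fm LK 0 1))) Fin.elim0 ![a]).allNE t
  simp only [Fm.instN, Fm.subst, Fm.subst_neg, Fm.wkN, boxF, Fm.subst_decZero] at this
  exact this

theorem Prov.cs2 (a : Fin m) : Prov TCS Γ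
    (.imp (decZero a) (.neg (.neg (.exN (boxF (.var 0) (decZero a)))))) := by
  have := Prov.inst (T := TCS) (Γ := Γ)
    (.inr (CS.cs2 (n := 0) (decZero 0 : Fm LK 0 1))) Fin.elim0 ![a]
  simp only [Fm.subst, Fm.subst_neg, Fm.wkN, boxF, Fm.subst_decZero] at this
  exact this

theorem Prov.cs3 (a : Fin m) : Prov TCS Γ
    (.imp (.exN (boxF (.var 0) (decZero a))) (decZero a)) := by
  have := Prov.inst (T := TCS) (Γ := Γ)
    (.inr (CS.cs3 (n := 0) (decZero 0 : Fm LK 0 1))) Fin.elim0 ![a]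
  simp only [Fm.subst, Fm.wkN, boxF, Fm.subst_decZero] at this
  exact this

theorem Prov.comprehension {k l : ℕ} (t : Tm LK (k + 1) l) (σ : Fin k → Tm LK n m)
    (ρ : Fin l → Fin m) : Prov TCS Γ
      (.exF (.allN (.eq (.app 0 (.var 0)) (t.subst (upN σ) ρ).wkF))) := by
  have := Prov.inst (T := TCS) (Γ := Γ) (.inl (.inl (.inr (PrAn2.mk t)))) σ ρ
  simp only [Fm.subst, Tm.app_subst, Tm.var_subst, upN_zero] at this
  have h : t.wkF.subst (upN fun i => (σ i).wkF) (upF ρ) = (t.subst (upN σ) ρ).wkF := by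
    simp only [Tm.wkF, Tm.subst_subst]
    congr 1
    funext i
    refine Fin.cases rfl (fun i => ?_) i
    simp only [upN, Fin.cases_succ, Tm.wkN, Tm.subst_subst, Tm.subst, id]
  rw [h] at this
  exact this

theorem Prov.allN_open {L : Lang} {T : Theory L} {Γ : List (Fm L n m)} {A : Fm L (n + 1) m}
    (h : Prov T Γ (.allN A)) : Prov T (Γ.map Fm.wkN) A := by
  have := (h.subst (fun i => .var i.succ) id fun _ hC => List.mem_map_of_mem hC).allNE (.var 0)
  rw [Fm.instN, Fm.subst_subst] at this
  refine Eq.mp (congrArg (Prov T _) ?_) this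
  conv_rhs => rw [← A.subst_var]
  congr 1
  funext i
  exact Fin.cases rfl (fun i => rfl) i

theorem Prov.allF_open {L : Lang} {T : Theory L} {Γ : List (Fm L n m)} {A : Fm L n (m + 1)}
    (h : Prov T Γ (.allF A)) : Prov T (Γ.map Fm.wkF) A := by
  have := (h.subst .var Fin.succ fun _ hC => List.mem_map_of_mem hC).allFE 0
  rw [Fm.instF, Fm.subst_subst] at this
  refine Eq.mp (congrArg (Prov T _) ?_) this
  conv_rhs => rw [← A.subst_var]
  congr 1
  funext i
  exact Fin.cases rfl (fun i => rfl) i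

theorem Prov.hasZero_of_gmp {a : Fin m} (hG : Prov TCS Γ gmp)
    (h : Prov TCS Γ (hasZero a).neg.neg) : Prov TCS Γ (hasZero a) := by
  have := hG.allFE a
  simp only [Fm.instF, Fm.subst, Fm.subst_neg, Fm.subst_hasZero] at this
  exact .impE this h

/-- The formula `∀ x, b(x) = χ(x, a)`, where `χ(x, a) = 0` if and only if
`¬¬ □_x (∀ y, a(y) = 0 ∨ ¬ ∀ y, a(y) = 0)`. -/
def graphChi (b a : Fin m) : Fm LK n m := .allN (.eq (.app b (.var 0)) (chiNotBox (.var 0) a))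

theorem Prov.boxF_of_graphChi {b a : Fin m} (h : Prov TCS Γ (graphChi b a)) {t : Tm LK n m}
    (ht : Prov TCS Γ (.eq (.app b t) zeroT)) : Prov TCS Γ (boxF t (decZero a)) := by
  have ht' : Prov TCS Γ (.eq (.app b t) (chiNotBox t a)) := h.allNE t
  have hnn : Prov TCS Γ (boxF t (decZero a)).neg.neg :=
    .impE (Prov.chi t a).andE₁ (ht'.eq_symm.eq_trans ht)
  exact .orE (.cs1 t a) .here (.botE (.impE (hnn.wk _) .here))

theorem Prov.eq_zero_of_graphChi {b a : Fin m} (h : Prov TCS Γ (graphChi b a)) {t : Tm LK n m}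
    (ht : Prov TCS Γ (boxF t (decZero a))) : Prov TCS Γ (.eq (.app b t) zeroT) := by
  have ht' : Prov TCS Γ (.eq (.app b t) (chiNotBox t a)) := h.allNE t
  exact ht'.eq_trans (.impE (Prov.chi t a).andE₂ (.impI (.impE .here (ht.wk _))))

theorem Prov.eq_of_isZero {a : Fin m} (h : Prov TCS Γ (isZero a)) (t : Tm LK n m) :
    Prov TCS Γ (.eq (.app a t) zeroT) := by
  have := h.allNE t
  simp only [Fm.instN, Fm.subst, Tm.app_subst, Tm.var_subst, Fin.cases_zero,
    Tm.subst_zeroT] at this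
  exact this

theorem Prov.hasZero_intro {a : Fin m} {t : Tm LK n m}
    (h : Prov TCS Γ (.eq (.app a t) zeroT)) : Prov TCS Γ (hasZero a) := by
  refine .exNI t ?_
  simp only [Fm.instN, Fm.subst, Tm.app_subst, Tm.var_subst, Fin.cases_zero, Tm.subst_zeroT]
  exact h

/-- Under Markov's principle the creating subject decides whether a sequence is zero: the
formula `decZero a` is not false, so it is not impossible that it is found at some stage, and
the stages where it has been found are the zeros of a choice sequence. -/
theorem Prov.decZero_of_gmp (a : Fin m) (hG : Prov TCS Γ gmp) : Prov TCS Γ (decZero a) := by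
  refine .exFE (A := graphChi 0 a.succ)
    (Prov.comprehension (chiNotBox (.var 0) 0 : Tm LK 1 1) Fin.elim0 fun _ => a) ?_
  rw [Fm.wkF, Fm.subst_decZero]
  replace hG := hG.wkF (graphChi 0 a.succ)
  rw [Fm.wkF, Fm.subst_gmp] at hG
  generalize Γ.map Fm.wkF = Δ at hG ⊢
  have h : Prov TCS (graphChi 0 a.succ :: Δ) (graphChi 0 a.succ) := .here
  generalize graphChi 0 a.succ :: Δ = Δ' at h hG
  have hbox := ((Prov.not_not_em (T := TCS) (Γ := Δ') (isZero a.succ)).not_not_map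
    (.impE (.cs2 _) .here)).not_not_join
  have hex : Prov TCS Δ' (hasZero 0) := by
    refine hG.hasZero_of_gmp (hbox.not_not_map (.exNE .here ?_))
    rw [Fm.wkN, Fm.subst_hasZero]
    have h' := (h.wk (.exN (boxF (.var 0) (decZero a.succ)))).wkN (boxF (.var 0) (decZero a.succ))
    exact (Prov.eq_zero_of_graphChi h' .here).hasZero_intro
  refine .impE (.cs3 _) (.exNE hex ?_)
  simp only [Fm.wkN, Fm.subst, boxF, Fm.subst_decZero, Tm.var_subst, upN_zero]
  refine .exNI (.var 0) ?_
  simp only [Fm.instN, Fm.subst, Fm.subst_decZero, Tm.var_subst, Fin.cases_zero]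
  exact Prov.boxF_of_graphChi (h.wkN (.eq (.app 0 (.var 0)) zeroT)) .here

/-- The formula `∀ α ∀ x, (x = c(α) → tests x α)`: the functional `c` decides whether a sequence
is zero. -/
def decides {L : Lang} {n m : ℕ} (c : Fin m) : Fm L n m :=
  .allF (.allN (.imp (valF c.succ 0 (.var 0)) (tests (.var 0) 0)))

theorem Fm.subst_decides {L : Lang} {n m n' m' : ℕ} (σ : Fin n → Tm L n' m') (ρ : Fin m → Fin m')
    (c : Fin m) : (decides c : Fm L n m).subst σ ρ = decides (ρ c) := by
  simp only [decides, Fm.subst, Fm.subst_valF, Fm.subst_tests]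
  rfl

theorem Prov.tests_of_decides {c b : Fin m} {w y z : Tm LK n m} (hc : Prov TCS Γ (decides c))
    (hb : Prov TCS Γ (barF b z w)) (hy : Prov TCS Γ (.eq (succT y) (.app c w))) :
    Prov TCS Γ (tests y b) := by
  have h := hc.allFE b
  simp only [Fm.instF, Fm.subst, Fm.subst_valF, Fm.subst_tests, Tm.var_subst] at h
  replace h := h.allNE y
  simp only [Fm.instN, Fm.subst, Fm.subst_valF, Fm.subst_tests,
    Fin.cases_zero, Fin.cases_succ] at h
  refine .impE h (.exNI z ?_)
  simp only [Fm.instN, Fm.subst, Fm.subst_barF, Tm.subst_succT, Tm.app_subst, Tm.var_subst,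
    upN_zero, upN_one, Fin.cases_zero, Tm.subst_wkN, Tm.wkN_subst_cases]
  refine .exNI w ?_
  simp only [Fm.instN, Fm.subst, Fm.subst_barF, Tm.subst_succT, Tm.app_subst, Tm.var_subst,
    Fin.cases_zero, Tm.wkN_subst_cases]
  exact .andI hb hy

/-- A functional that decides whether a sequence is zero is contradictory: its value at `a`, which
is zero, depends on the first `z` values of `a` only, and `a'` has these values but is not zero. -/
theorem Prov.bot_of_monus {c a a' : Fin m} {w y z : Tm LK n m} (hc : Prov TCS Γ (decides c))
    (ha : Prov TCS Γ (isZero a))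
    (ha' : Prov TCS Γ (.allN (.eq (.app a' (.var 0)) (.pr .monus ![z.wkN, succT (.var 0)]))))
    (hw : Prov TCS Γ (barF a z w)) (hy : Prov TCS Γ (.eq (succT y) (.app c w))) :
    Prov TCS Γ .bot := by
  have hT := PrAn1_subset_TCS
  have hw' : Prov TCS Γ (barF a' z w) := by
    refine .andI hw.andE₁ (.allNI (.impI ?_))
    -- `w_i = a(i) = 0 = (i + 1) ∸ z = a'(i)` for `i < z`
    refine (Prov.impE (hw.andE₂.allN_open.wk _) .here).eq_trans
      ((ha.allN_open.wk _).eq_trans (Prov.eq_symm ((ha'.allN_open.wk _).eq_trans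
        (.exNE .here ?_))))
    simp only [Fm.wkN, Fm.subst, Tm.subst_pr_two, Tm.subst_succT, Tm.var_subst, Tm.subst_zeroT]
    exact (Prov.here.eq_symm.pr_left .monus _).eq_trans (Prov.monus_add hT _ _)
  have hy₀ : Prov TCS Γ (.eq y zeroT) := .impE (hc.tests_of_decides hw hy).andE₂ ha
  have hz : Prov TCS Γ (.eq (.app a' z) zeroT) :=
    Prov.eq_of_isZero (.impE (hc.tests_of_decides hw' hy).andE₁ hy₀) z
  have hz' := ha'.allNE z
  simp only [Fm.instN, Fm.subst, Tm.app_subst, Tm.subst_pr_two, Tm.subst_succT,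
    Tm.var_subst, Fin.cases_zero, Tm.wkN_subst_cases] at hz'
  exact .impE (Prov.succ_ne_zero hT zeroT)
    ((Prov.monus_self_succ hT z).eq_symm.eq_trans (hz'.eq_symm.eq_trans hz))

theorem Prov.bot_of_value {c a : Fin m} {w y z : Tm LK n m} (hc : Prov TCS Γ (decides c))
    (ha : Prov TCS Γ (isZero a)) (hw : Prov TCS Γ (barF a z w))
    (hy : Prov TCS Γ (.eq (succT y) (.app c w))) : Prov TCS Γ .bot := by
  have h := Prov.comprehension (Γ := Γ)
    (.pr .monus ![.var 1, succT (.var 0)] : Tm LK 2 0) (fun _ => z) Fin.elim0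
  simp only [Tm.wkF, Tm.subst_pr_two, Tm.subst_succT, Tm.var_subst, upN_zero, upN_one] at h
  refine .exFE h (C := .bot) ?_
  refine Prov.bot_of_monus (c := c.succ) (a := a.succ) (a' := 0) (w := w.wkF) (y := y.wkF)
    (z := z.wkF) ?_ ?_ ?_ ?_ ?_
  · simpa only [Fm.wkF, Fm.subst_decides] using hc.wkF _
  · simpa only [Fm.wkF, Fm.subst_isZero] using ha.wkF _
  · have : z.wkF.wkN = z.wkN.subst .var Fin.succ := by
      simp only [Tm.wkF, Tm.wkN, Tm.subst_subst]
      rfl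
    rw [this]
    exact .here
  · simpa only [Fm.wkF, Fm.subst_barF, Tm.wkF] using hw.wkF _
  · simpa only [Fm.wkF, Fm.subst, Tm.subst_succT, Tm.app_subst, Tm.wkF] using hy.wkF _

theorem Prov.bot_of_barF {c a : Fin m} {w z : Tm LK n m} (hc : Prov TCS Γ (decides c))
    (ha : Prov TCS Γ (isZero a)) (hw : Prov TCS Γ (barF a z w))
    (hy : Prov TCS Γ (.neg (.eq (.app c w) zeroT))) : Prov TCS Γ .bot := by
  refine .exNE (Prov.exists_eq_succ PrAn1_subset_TCS hy) (C := .bot) ?_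
  refine Prov.bot_of_value (c := c) (a := a) (w := w.wkN) (z := z.wkN) (y := .var 0) ?_ ?_ ?_ .here
  · simpa only [Fm.wkN, Fm.subst_decides, id] using hc.wkN _
  · simpa only [Fm.wkN, Fm.subst_isZero, id] using ha.wkN _
  · simpa only [Fm.wkN, Fm.subst_barF, Tm.wkN, id] using hw.wkN _

theorem Prov.bot_of_inK0 {c a : Fin m} (hc : Prov TCS Γ (decides c)) (hK : Prov TCS Γ (inK0 c))
    (ha : Prov TCS Γ (isZero a)) : Prov TCS Γ .bot := by
  have h := hK.andE₂.allFE a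
  simp only [Fm.instF, Fm.subst, Fm.subst_neg, Fm.subst_barF, Tm.app_subst, Tm.var_subst,
    Tm.subst_zeroT, Fin.cases_zero, Fin.cases_succ, id] at h
  refine .exNE h (C := .bot) (.exNE .here (C := .bot) ?_)
  refine Prov.bot_of_barF (c := c) (a := a) (w := .var 0) (z := .var 1) ?_ ?_ Prov.here.andE₁
    Prov.here.andE₂
  · simpa only [Fm.wkN, Fm.subst_decides, id] using (hc.wkN _).wkN _
  · simpa only [Fm.wkN, Fm.subst_isZero, id] using (ha.wkN _).wkN _

/-- Continuity for the formula `tests`. -/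
theorem Prov.exists_decides (h : Prov TCS Γ (.allF (.exN (tests (.var 0) 0)))) :
    Prov TCS Γ (.exF (.and (inK0 0) (decides 0))) := by
  have hmap {L L' : Lang} (s : ∀ k l : ℕ, L.Sym k l → L'.Sym k l) (b : L.Box → L'.Box) :
      (Fm.imp (.allF (.exN (tests (.var 0) 0))) (.exF (.and (inK0 0)
        (.allF (.allN (.imp (valF 1 0 (.var 0))
          ((tests (.var 0) 0 : Fm L 1 1).subst .var (upF Fin.succ))))))) : Sentence L).map s b =
      .imp (.allF (.exN (tests (.var 0) 0))) (.exF (.and (inK0 0) (decides 0))) := by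
    simp only [Fm.map, Fm.map_tests, Fm.map_inK0, Fm.map_valF, Fm.subst_tests]
    rfl
  have hax := BCN.mk (n := 0) (m := 0) (tests (.var 0) 0 : Fm L₀ 1 1)
  rw [Fm.closure_zero] at hax
  have := Prov.ax (T := TCS) (Γ := Γ) (.inl (.inr ⟨_, hax, hmap _ _⟩))
  simp only [Fm.ofSentence, Fm.subst, Fm.subst_tests, Fm.subst_inK0, Fm.subst_decides] at this
  exact .impE this h

theorem Prov.bot_of_decZero (h : Prov TCS Γ (.allF (decZero 0))) : Prov TCS Γ .bot := by
  have intro_ex {m : ℕ} {Γ : List (Fm LK n m)} {a : Fin m} (t : Tm LK n m)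
      (h : Prov TCS Γ (tests t a)) : Prov TCS Γ (.exN (tests (.var 0) a)) := by
    refine .exNI t ?_
    simpa only [Fm.instN, Fm.subst_tests, Tm.var_subst, Fin.cases_zero, id] using h
  have hex : Prov TCS Γ (.allF (.exN (tests (.var 0) 0))) := by
    refine .allFI (.orE h.allF_open (intro_ex zeroT ?_) (intro_ex (succT zeroT) ?_))
    · exact .andI (.impI (Prov.here.wk _)) (.impI (.eqI _))
    · exact .andI (.impI (.botE (.impE (.succ_ne_zero PrAn1_subset_TCS _) .here)))
        (.impI (.botE (.impE (Prov.here.wk _) .here)))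
  refine .exFE (Prov.exists_decides hex) (C := .bot) ?_
  have hzero := Prov.comprehension (Γ := .and (inK0 0) (decides 0) :: Γ.map Fm.wkF)
    (zeroT : Tm LK 1 0) Fin.elim0 Fin.elim0
  simp only [Tm.wkF, Tm.subst_zeroT] at hzero
  refine .exFE hzero (C := .bot) ?_
  refine Prov.bot_of_inK0 (c := 1) (a := 0) ?_ ?_ .here
  · have := (Prov.andE₂ (Prov.here (T := TCS) (A := .and (inK0 0) (decides 0))
      (Γ := Γ.map Fm.wkF))).wkF (isZero 0)
    rw [Fm.wkF, Fm.subst_decides] at this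
    exact this
  · have := (Prov.andE₁ (Prov.here (T := TCS) (A := .and (inK0 0) (decides 0))
      (Γ := Γ.map Fm.wkF))).wkF (isZero 0)
    rw [Fm.wkF, Fm.subst_inK0] at this
    exact this

theorem TCS_proves_not_GMP : Proves TCS (Fm.neg GMP).toLK := by
  have h : (Fm.neg GMP).toLK = .neg gmp := congrArg Fm.neg toLK_GMP
  rw [h]
  refine .impI (.bot_of_decZero (.allFI (Prov.decZero_of_gmp 0 (.hyp ?_))))
  rw [List.map_singleton, Fm.wkF, Fm.subst_gmp]
  exact List.mem_cons_self

end Markov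

end CreatingSubject

/-! ### Non-conservativity -/

theorem proposition2 :
    -- `FIM₀⁺ + CS` is an extension of `FIM₀`, and it is conservative neither over `FIM₀`
    -- nor over `FIM`
    CreatingSubject.IsExtension (CreatingSubject.FIM₀plus ∪ CreatingSubject.CS) CreatingSubject.FIM₀ ∧
    ¬ CreatingSubject.IsConservative (CreatingSubject.FIM₀plus ∪ CreatingSubject.CS) CreatingSubject.FIM₀ ∧
    ¬ CreatingSubject.IsConservative (CreatingSubject.FIM₀plus ∪ CreatingSubject.CS) CreatingSubject.FIM ∧
    -- the reason: it refutes `GMP`, which is consistent with `FIM`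
    CreatingSubject.Proves (CreatingSubject.FIM₀plus ∪ CreatingSubject.CS) (CreatingSubject.Fm.toLK (.neg CreatingSubject.GMP)) ∧
    CreatingSubject.Consistent (insert CreatingSubject.GMP CreatingSubject.FIM) := by
  open CreatingSubject in
  have unprovable : ¬ Proves FIM (.neg GMP) := by
    intro h
    refine consistent_insert_GMP_FIM (Prov.impE (Prov.mono (Set.subset_insert _ _) h) ?_)
    have := Prov.ax (T := insert GMP FIM) (Γ := ([] : List (Sentence L₀))) (Set.mem_insert GMP FIM)
    rwa [Fm.ofSentence_self] at this
  have h₀ : FIM₀ ⊆ FIM := fun A hA => .inl (.inl (.inl hA))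
  exact ⟨FIM₀.isExtension _ Set.subset_union_left,
    fun h => unprovable (Prov.mono h₀ (h _ TCS_proves_not_GMP)),
    fun h => unprovable (h _ TCS_proves_not_GMP), TCS_proves_not_GMP, consistent_insert_GMP_FIM⟩
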